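/- **Notation.** Let $\mu\ge 0$, $L>0$, $n\in\mathbb N_0$. Let $\Pi_n^3$ be the space of real polynomials in three variables of total degree $\le n$, let $B^2$ be the closed unit disk, $B_L=B^2\times[0,L]$, $W_\mu(x,y)=(1-x^2-y^2)^{\mu-1/2}$, $a_\mu=(\mu+\tfrac12)/\pi$, and $$\mathcal R_\theta^\mu(g;t)=\int_{-\sqrt{1-t^2}}^{\sqrt{1-t^2}} g(t\cos\theta-s\sin\theta,\;t\sin\theta+s\cos\theta)\,W_\mu(s,t)\,ds .$$ Let $C_k^{\lambda}$ be the Gegenbauer polynomials ($C_0^\lambda=1$, $C_1^\lambda(t)=2\lambda t$, $kC_k^\lambda(t)=2(k+\lambda-1)tC_{k-1}^\lambda(t)-(k+2\lambda-2)C_{k-2}^\lambda(t)$). Let $p_l^{(\alpha,\beta)}$ be the Jacobi polynomials that are orthonormal with respect to $(1-s)^\alpha(1+s)^\beta$ normalized to have integral $1$ on $[-1,1]$, and let $p_l$ be the polynomials that are orthonormal with respect to $W_L(z)=\frac1{\pi\sqrt{z(L-z)}}$ on $[0,L]$. For $0\le 2l\le k$ put $$h_{l,k}^2=\frac{\Gamma(k-2l+\mu+\frac32)}{\Gamma(\mu+\frac32)\,\Gamma(k-2l+1)},\qquad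 H_{l,k}=h_{l,k}\,p_l^{(\mu-\frac12,k-2l)}(1),$$ $$P_{l,\varepsilon}^k(r\cos\phi,r\sin\phi)=\delta_{l,k}\,h_{l,k}\,p_l^{(\mu-\frac12,k-2l)}(2r^2-1)\,r^{k-2l}S_{k-2l,\varepsilon}(\phi),$$ where $S_{m,0}(\phi)=\cos m\phi$, $S_{m,1}(\phi)=\sin m\phi$, $\delta_{l,k}=\sqrt2$ if $2l<k$ and $\delta_{l,k}=1$ if $2l=k$. (These functions, with $\varepsilon=0$ only when $2l=k$, are the orthonormal basis of the orthogonal polynomials of degree $k$ for $a_\mu W_\mu$ on $B^2$.) Let $$D_k(\xi;x,y)=\sum_{0\le 2l\le k}\sum_{\varepsilon} H_{l,k}^{-2}\,P_{l,\varepsilon}^k(\cos\xi,\sin\xi)\,P_{l,\varepsilon}^k(x,y),$$ $$\Phi_n(\xi,w,t;\mathbf x)=\sum_{k=0}^n\frac{k+\mu+\frac12}{\mu+\frac12}\,C_k^{\mu+1/2}(t)\,D_k(\xi;x_1,x_2)\sum_{l=0}^{n-k}p_l(w)\,p_l(x_3).$$ **Theorem.** Let $a\in\mathbb R$ be such that $C_{n+1}^{\mu+1/2}+a\,C_n^{\mu+1/2}$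 has $n+1$ distinct zeros $t_0,\dots,t_n$ in $(-1,1)$, and let $\lambda_j=\int_{-1}^1\ell_j(t)(1-t^2)^\mu\,dt$, with $\ell_j$ the Lagrange basis polynomials at the nodes $t_0,\dots,t_n$, be the weights of the corresponding interpolatory quadrature formula. Let $\xi_\nu=\frac{\nu\pi}{n+1}$ and $z_i=\frac L2\bigl(1+\cos\frac{(2i+1)\pi}{2n+2}\bigr)$ for $0\le \nu,i\le n$, and define $$\mathcal B_{n,L}^\mu(f;\mathbf x)=\sum_{\nu=0}^n\sum_{j=0}^n\sum_{i=0}^n \mathcal R_{\xi_\nu}^\mu(f(\cdot,\cdot,z_i);t_j)\,\frac{a_\mu\lambda_j}{(n+1)^2}(1-t_j^2)^{-\mu}\,\Phi_n(\xi_\nu,z_i,t_j;\mathbf x).$$ Then $\mathcal B_{n,L}^\mu$ is a projection operator on $\Pi_n^3$: $\mathcal B_{n,L}^\mu f\in\Pi_n^3$ for every function $f$ on $B_L$ (for which the above Radon projections exist), and $\mathcal B_{n,L}^\mu f=f$ whenever $f$ is (the restriction to $B_L$ of) a polynomial in $\Pi_n^3$. -/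

import Mathlib

open Polynomial

noncomputable section

namespace CylRecon

/-! ### Orthogonal polynomials in one variable -/

/-- The bilinear form `⟨p, q⟩ = ∫ₐᵇ p(x) q(x) w(x) dx` on polynomials. -/
def weightedInner (w : ℝ → ℝ) (a b : ℝ) (p q : ℝ[X]) : ℝ :=
  ∫ x in a..b, p.eval x * q.eval x * w x

/-- The monic orthogonal polynomial of degree `k` for the weight `w` on `[a, b]`
(Gram–Schmidt applied to `1, X, X², …`). -/
def monicOrthogonal (w : ℝ → ℝ) (a b : ℝ) (k : ℕ) : ℝ[X] :=
  X ^ k - ∑ j : Fin k,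
    C (weightedInner w a b (X ^ k) (monicOrthogonal w a b j) /
        weightedInner w a b (monicOrthogonal w a b j) (monicOrthogonal w a b j)) *
      monicOrthogonal w a b j
termination_by k
decreasing_by all_goals exact j.isLt

/-- The orthonormal polynomial of degree `k` (positive leading coefficient) for the weight `w`
on `[a, b]`. -/
def orthonormalPoly (w : ℝ → ℝ) (a b : ℝ) (k : ℕ) : ℝ[X] :=
  C (1 / √(weightedInner w a b (monicOrthogonal w a b k) (monicOrthogonal w a b k))) *
    monicOrthogonal w a b k

/-- The Gegenbauer polynomial `C_k^lam`, by its three-term recurrence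
`k C_k = 2 (k + lam - 1) X C_{k-1} - (k + 2 lam - 2) C_{k-2}`, `C_0 = 1`, `C_1 = 2 lam X`. -/
def gegenbauer (lam : ℝ) : ℕ → ℝ[X]
  | 0 => 1
  | 1 => C (2 * lam) * X
  | (k + 2) =>
      C (2 * (k + 1 + lam) / (k + 2)) * X * gegenbauer lam (k + 1)
        - C ((k + 2 * lam) / (k + 2)) * gegenbauer lam k

/-- The Jacobi weight `(1-s)^α (1+s)^β`, normalized to have integral `1` on `[-1, 1]`. -/
def jacobiWeight (α β : ℝ) (s : ℝ) : ℝ :=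
  (1 - s) ^ α * (1 + s) ^ β / ∫ u in (-1 : ℝ)..1, (1 - u) ^ α * (1 + u) ^ β

/-- The orthonormal Jacobi polynomial `p_l^{(α, β)}`. -/
def jacobiOrthonormal (α β : ℝ) (l : ℕ) : ℝ[X] :=
  orthonormalPoly (jacobiWeight α β) (-1) 1 l

/-- The Chebyshev weight `W_L(z) = 1 / (π √(z (L - z)))` on `[0, L]`. -/
def chebyshevWeight (L z : ℝ) : ℝ := 1 / (Real.pi * √(z * (L - z)))

/-- The orthonormal polynomial `p_k` of degree `k` with respect to `W_L` on `[0, L]`. -/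
def axialOrthonormal (L : ℝ) (k : ℕ) : ℝ[X] := orthonormalPoly (chebyshevWeight L) 0 L k

/-! ### The orthonormal basis on the disk -/

/-- In polar coordinates `x = r cos φ`, `y = r sin φ`, this is `r ^ m * cos (m φ)` for `ε = 0`
and `r ^ m * sin (m φ)` for `ε = 1`. -/
def angular (ε : Fin 2) (m : ℕ) (x y : ℝ) : ℝ :=
  if ε = 0 then (((x : ℂ) + y * Complex.I) ^ m).re else (((x : ℂ) + y * Complex.I) ^ m).im

/-- `h_{l,k} = (Γ(k-2l+μ+3/2) / (Γ(μ+3/2) Γ(k-2l+1)))^{1/2}`, used for `2 l ≤ k`. -/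
def hConst (μ : ℝ) (l k : ℕ) : ℝ :=
  √(Real.Gamma (((k - 2 * l : ℕ) : ℝ) + μ + 3 / 2) /
    (Real.Gamma (μ + 3 / 2) * Real.Gamma (((k - 2 * l : ℕ) : ℝ) + 1)))

/-- The element `P_{l,ε}^k` (`2 l ≤ k`) of the orthonormal basis of the orthogonal polynomials of
degree `k` on the unit disk for the normalized weight `a_μ (1 - x² - y²)^{μ - 1/2}`. The factor
`√2` for `2 l < k` is the normalization of `cos (m φ)` and `sin (m φ)` with `m > 0`.
For `2 l = k` only `ε = 0` is a basis element; `ε = 1` then gives the zero function. -/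
def discBasis (μ : ℝ) (ε : Fin 2) (l k : ℕ) (x y : ℝ) : ℝ :=
  (if 2 * l < k then √2 else 1) * hConst μ l k *
    (jacobiOrthonormal (μ - 1 / 2) ((k - 2 * l : ℕ) : ℝ) l).eval (2 * (x ^ 2 + y ^ 2) - 1) *
      angular ε (k - 2 * l) x y

/-- `H_{l,k}^μ = h_{l,k} p_l^{(μ - 1/2, k - 2l)}(1)`. -/
def HConst (μ : ℝ) (l k : ℕ) : ℝ :=
  hConst μ l k * (jacobiOrthonormal (μ - 1 / 2) ((k - 2 * l : ℕ) : ℝ) l).eval 1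

/-- `D_k^{μ+1/2}(ξ; x, y) = ∑_{l, ε} (H_{l,k}^μ)⁻² P_{l,ε}^k(cos ξ, sin ξ) P_{l,ε}^k(x, y)`. -/
def DKernel (μ : ℝ) (k : ℕ) (ξ x y : ℝ) : ℝ :=
  ∑ l ∈ Finset.range (k / 2 + 1), ∑ ε : Fin 2,
    (1 / HConst μ l k ^ 2) *
      discBasis μ ε l k (Real.cos ξ) (Real.sin ξ) * discBasis μ ε l k x y

/-! ### The reconstruction operator on the cylinder -/

/-- The cylinder `B_L = B² × [0, L]`. -/
def cylinder (L : ℝ) : Set (Fin 3 → ℝ) :=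
  {x | x 0 ^ 2 + x 1 ^ 2 ≤ 1 ∧ 0 ≤ x 2 ∧ x 2 ≤ L}

/-- The attenuated Radon projection `R_θ^μ(g; t)`: the integral of `g W_μ`, with
`W_μ(x, y) = (1 - x² - y²)^{μ - 1/2}`, over the segment `{x cos θ + y sin θ = t} ∩ B²`. -/
def radon (μ : ℝ) (g : ℝ → ℝ → ℝ) (θ t : ℝ) : ℝ :=
  ∫ s in (-√(1 - t ^ 2))..√(1 - t ^ 2),
    g (t * Real.cos θ - s * Real.sin θ) (t * Real.sin θ + s * Real.cos θ) *
      (1 - s ^ 2 - t ^ 2) ^ (μ - 1 / 2)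

/-- The kernel `Φ_n^μ(ξ, w, t; x)`. -/
def PhiKernel (μ L : ℝ) (n : ℕ) (ξ w t : ℝ) (x : Fin 3 → ℝ) : ℝ :=
  ∑ k ∈ Finset.range (n + 1),
    ((k + μ + 1 / 2) / (μ + 1 / 2)) * (gegenbauer (μ + 1 / 2) k).eval t *
      DKernel μ k ξ (x 0) (x 1) *
        ∑ l ∈ Finset.range (n - k + 1),
          (axialOrthonormal L l).eval w * (axialOrthonormal L l).eval (x 2)

/-- The weight `λ_j` of the `(n+1)`-point interpolatory quadrature formula with nodes `t` for the
weight function `(1 - s²)^μ` on `[-1, 1]`: the integral of the `j`-th Lagrange basis polynomial. It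
is the only choice of weights for which the formula is exact on polynomials of degree `≤ n`. -/
def quadWeight (μ : ℝ) {n : ℕ} (t : Fin (n + 1) → ℝ) (j : Fin (n + 1)) : ℝ :=
  ∫ s in (-1 : ℝ)..1, (Lagrange.basis Finset.univ t j).eval s * (1 - s ^ 2) ^ μ

/-- The equally spaced angles `ξ_ν = ν π / (n + 1)`. -/
def angle (n : ℕ) (ν : Fin (n + 1)) : ℝ := (ν : ℝ) * Real.pi / ((n : ℝ) + 1)

/-- The Chebyshev–Gauss nodes `z_i = (L / 2) (1 + cos ((2 i + 1) π / (2 n + 2)))` on `[0, L]`. -/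
def zNode (L : ℝ) (n : ℕ) (i : Fin (n + 1)) : ℝ :=
  L / 2 * (1 + Real.cos ((2 * (i : ℝ) + 1) * Real.pi / (2 * (n : ℝ) + 2)))

/-- `T_{ν,j,i}(x)`, with `a_μ = (μ + 1/2) / π`; one factor `1 / (n + 1)` comes from the average
over the angles and the other one is the weight of the Chebyshev–Gauss quadrature. -/
def TPoly (μ L : ℝ) (n : ℕ) (t : Fin (n + 1) → ℝ) (ν j i : Fin (n + 1)) (x : Fin 3 → ℝ) : ℝ :=
  ((μ + 1 / 2) / Real.pi) * quadWeight μ t j / ((n : ℝ) + 1) ^ 2 *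
    (1 - t j ^ 2) ^ (-μ) * PhiKernel μ L n (angle n ν) (zNode L n i) (t j) x

/-- The discretized reconstruction operator `B_{n,L}^μ` on the cylinder, with nodes `t_j`. -/
def cylOperator (μ L : ℝ) (n : ℕ) (t : Fin (n + 1) → ℝ) (f : (Fin 3 → ℝ) → ℝ)
    (x : Fin 3 → ℝ) : ℝ :=
  ∑ ν : Fin (n + 1), ∑ j : Fin (n + 1), ∑ i : Fin (n + 1),
    radon μ (fun x₁ x₂ => f ![x₁, x₂, zNode L n i]) (angle n ν) (t j) *
      TPoly μ L n t ν j i x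

end CylRecon

end

open Polynomial

noncomputable section

namespace CylRecon

open MeasureTheory Set
open scoped Polynomial.Bivariate

/-! ### Orthogonal polynomials for an integrable positive weight -/

/-! Everything rests on Marr's formula (`radon_discBasis`): if `P` is a disk basis element of degree
`k`, then `R_θ(P; t)` equals `(1 - t²)^μ P(cos θ, sin θ) C_k(t) / C_k(1)` up to a factor `c = ∫ (1 -
s²)^(μ - 1/2) ds`. The variables `θ` and `t` separate, so on a product `P(x₀, x₁) p_m(x₂)` with `k +
m ≤ n` the triple sum splits, for each index `k'` of the kernel `Φ`, into three independent discrete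
orthogonality relations.

The sum over the nodes `t_j` is `∫ C_k C_{k'} (1 - t²)^μ`, because the quadrature is exact up to
degree `2 n` (`sum_quadWeight_mul_eval`); only `k' = k` survives. The sum over the angles then
returns `(n + 1) P` (`sum_discBasis_mul_DKernel`), and the sum over the Chebyshev nodes returns `(n
+ 1) p_m` (`sum_axialOrthonormal_mul_axialOrthonormal`), since `m ≤ n - k`. The constants cancel by
the norm of `C_k` (`gegenbauerIntegral_gegenbauer_mul_self`) and the total mass of the disk weight
(`integral_chord_mul_gegenbauerIntegral_one`).

Marr's formula itself is an orthogonality argument. The chord average of `P` is a polynomial in `t`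
of degree at most `k`; integrated over all parallel chords against `t^i`, `i < k`, it gives a disk
integral of `P x^i`, which is zero. Hence it is a multiple of `C_k`, and the multiple is read off at
`t = 1`, where the chord degenerates to a point.

The products above span the polynomials of degree at most `n` in three variables, which gives
reproduction by linearity. Conversely the kernel is such a polynomial in `x`, which bounds the
range. -/

theorem intervalIntegrable_eval_mul {w : ℝ → ℝ} {a b : ℝ} (hw : IntervalIntegrable w volume a b)
    (p : ℝ[X]) : IntervalIntegrable (fun x => p.eval x * w x) volume a b :=
  hw.continuousOn_mul p.continuous.continuousOn

/-- Integration of a polynomial against an integrable weight, as a linear functional. -/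
def weightedIntegral (w : ℝ → ℝ) (a b : ℝ) (hw : IntervalIntegrable w volume a b) :
    ℝ[X] →ₗ[ℝ] ℝ where
  toFun p := ∫ x in a..b, p.eval x * w x
  map_add' p q := by
    rw [← intervalIntegral.integral_add (intervalIntegrable_eval_mul hw p)
      (intervalIntegrable_eval_mul hw q)]
    simp [add_mul]
  map_smul' c p := by
    rw [RingHom.id_apply, smul_eq_mul, ← intervalIntegral.integral_const_mul]
    simp [mul_assoc]

theorem weightedIntegral_apply {w : ℝ → ℝ} {a b : ℝ} (hw : IntervalIntegrable w volume a b)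
    (p : ℝ[X]) : weightedIntegral w a b hw p = ∫ x in a..b, p.eval x * w x := rfl

theorem weightedInner_eq {w : ℝ → ℝ} {a b : ℝ} (hw : IntervalIntegrable w volume a b)
    (p q : ℝ[X]) : weightedInner w a b p q = weightedIntegral w a b hw (p * q) := by
  simp [weightedInner, weightedIntegral_apply]

/-- A nonzero polynomial has finitely many zeros, so the nonnegative integrand is positive almost
everywhere on the interval. -/
theorem weightedIntegral_pos {w : ℝ → ℝ} {a b : ℝ} (hab : a < b)
    (hw : IntervalIntegrable w volume a b) (hpos : ∀ x ∈ Ioo a b, 0 < w x) {p : ℝ[X]}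
    (hp : ∀ x ∈ Ioo a b, 0 ≤ p.eval x) (hp0 : p ≠ 0) : 0 < weightedIntegral w a b hw p := by
  rw [weightedIntegral_apply, intervalIntegral.integral_of_le hab.le, integral_Ioc_eq_integral_Ioo]
  have hint : IntegrableOn (fun x => p.eval x * w x) (Ioo a b) := by
    have := intervalIntegrable_eval_mul hw p
    rwa [intervalIntegrable_iff_integrableOn_Ioo_of_le hab.le] at this
  rw [setIntegral_pos_iff_support_of_nonneg_ae _ hint]
  · have hfin : ({x | p.eval x = 0} : Set ℝ).Finite := by
      refine (p.rootSet_finite ℝ).subset fun x hx => ?_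
      rw [mem_rootSet]
      exact ⟨hp0, by simpa using hx⟩
    have hsub : Ioo a b \ {x | p.eval x = 0} ⊆
        (Function.support fun x => p.eval x * w x) ∩ Ioo a b := fun x hx =>
      ⟨mul_ne_zero hx.2 (hpos x hx.1).ne', hx.1⟩
    refine lt_of_lt_of_le ?_ (measure_mono hsub)
    rw [measure_sdiff_null (hfin.measure_zero volume)]
    simpa using hab
  · refine (ae_restrict_iff' measurableSet_Ioo).2 (Filter.Eventually.of_forall fun x hx => ?_)
    exact mul_nonneg (hp x hx) (hpos x hx).le

theorem weightedInner_self_pos {w : ℝ → ℝ} {a b : ℝ} (hab : a < b)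
    (hw : IntervalIntegrable w volume a b) (hpos : ∀ x ∈ Ioo a b, 0 < w x) {p : ℝ[X]}
    (hp0 : p ≠ 0) : 0 < weightedInner w a b p p := by
  rw [weightedInner_eq hw]
  exact weightedIntegral_pos hab hw hpos (fun x _ => by simpa using mul_self_nonneg _)
    (mul_self_ne_zero.2 hp0)

theorem monicOrthogonal_eq (w : ℝ → ℝ) (a b : ℝ) (k : ℕ) :
    monicOrthogonal w a b k = X ^ k - ∑ j : Fin k,
      C (weightedInner w a b (X ^ k) (monicOrthogonal w a b j) /
        weightedInner w a b (monicOrthogonal w a b j) (monicOrthogonal w a b j)) *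
      monicOrthogonal w a b j := by
  conv_lhs => rw [monicOrthogonal]

theorem monicOrthogonal_isMonicOfDegree (w : ℝ → ℝ) (a b : ℝ) (k : ℕ) :
    IsMonicOfDegree (monicOrthogonal w a b k) k := by
  induction k using Nat.strong_induction_on with
  | _ k ih =>
    rw [monicOrthogonal_eq]
    cases k with
    | zero => simp
    | succ k =>
      refine (isMonicOfDegree_X_pow ℝ (k + 1)).sub (Nat.lt_succ_of_le ?_)
      refine natDegree_sum_le_of_forall_le _ _ fun j _ => (natDegree_C_mul_le _ _).trans ?_
      rw [(ih j j.2).natDegree_eq]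
      exact Nat.le_of_lt_succ j.2

theorem weightedInner_monicOrthogonal_of_lt {w : ℝ → ℝ} {a b : ℝ} (hab : a < b)
    (hw : IntervalIntegrable w volume a b) (hpos : ∀ x ∈ Ioo a b, 0 < w x) (k : ℕ) :
    ∀ i < k, weightedIntegral w a b hw (monicOrthogonal w a b k * monicOrthogonal w a b i) = 0 := by
  induction k using Nat.strong_induction_on with
  | _ k ih =>
    intro i hi
    have hne := (weightedInner_self_pos hab hw hpos
      (monicOrthogonal_isMonicOfDegree w a b i).monic.ne_zero).ne'
    rw [monicOrthogonal_eq w a b k, sub_mul, Finset.sum_mul, map_sub, map_sum,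
      Finset.sum_eq_single ⟨i, hi⟩]
    · rw [mul_assoc, ← smul_eq_C_mul, map_smul, ← weightedInner_eq, ← weightedInner_eq, smul_eq_mul,
        div_mul_cancel₀ _ hne, sub_self]
    · intro j _ hj
      rw [mul_assoc, ← smul_eq_C_mul, map_smul]
      have hj' : (j : ℕ) ≠ i := fun h => hj (Fin.ext h)
      rcases lt_or_gt_of_ne hj' with h | h
      · rw [mul_comm (monicOrthogonal w a b j), ih i hi j h, smul_zero]
      · rw [ih j j.2 i h, smul_zero]
    · simp

/-- A triangular sequence of polynomials spans each space of polynomials of bounded degree. -/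
theorem mem_span_of_natDegree_eq {p : ℕ → ℝ[X]} (hp0 : ∀ k, p k ≠ 0)
    (hp : ∀ k, (p k).natDegree = k) (q : ℝ[X]) :
    q ∈ Submodule.span ℝ (p '' Iic q.natDegree) := by
  have main : ∀ d : ℕ, ∀ q : ℝ[X], q.natDegree ≤ d → q ∈ Submodule.span ℝ (p '' Iic d) := by
    intro d
    induction d with
    | zero =>
      intro q hq
      obtain ⟨c, rfl⟩ : ∃ c, q = C c := ⟨_, eq_C_of_natDegree_le_zero hq⟩
      obtain ⟨e, he⟩ : ∃ e, p 0 = C e := ⟨_, eq_C_of_natDegree_le_zero (hp 0).le⟩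
      have he0 : e ≠ 0 := fun h => hp0 0 (by rw [he, h, C_0])
      have : C c = (c / e) • p 0 := by
        rw [he, smul_C, smul_eq_mul, div_mul_cancel₀ _ he0]
      rw [this]
      exact Submodule.smul_mem _ _ (Submodule.subset_span ⟨0, by simp, rfl⟩)
    | succ d ih =>
      intro q hq
      set e := (p (d + 1)).coeff (d + 1) with he
      have he0 : e ≠ 0 := by
        have := hp0 (d + 1)
        rwa [← leadingCoeff_ne_zero, leadingCoeff, hp] at this
      -- Cancelling the coefficient of `X ^ (d + 1)` with a multiple of `p (d + 1)` lowers the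
      -- degree.
      have hr : (q - (q.coeff (d + 1) / e) • p (d + 1)).natDegree ≤ d := by
        rw [natDegree_le_iff_coeff_eq_zero]
        intro N hN
        rcases eq_or_lt_of_le (Nat.succ_le_of_lt hN) with h | h
        · rw [← h]
          simp only [Nat.succ_eq_add_one, coeff_sub, coeff_smul, smul_eq_mul]
          rw [← he, div_mul_cancel₀ _ he0, sub_self]
        · have h1 : q.natDegree < N := lt_of_le_of_lt hq h
          have h2 : (p (d + 1)).natDegree < N := by rw [hp]; exact h
          simp [coeff_eq_zero_of_natDegree_lt h1, coeff_eq_zero_of_natDegree_lt h2]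
      have := ih _ hr
      rw [← sub_add_cancel q ((q.coeff (d + 1) / e) • p (d + 1))]
      refine Submodule.add_mem _ (Submodule.span_mono (image_mono ?_) this)
        (Submodule.smul_mem _ _ (Submodule.subset_span ⟨d + 1, by simp, rfl⟩))
      exact Iic_subset_Iic.2 d.le_succ
  exact main _ q le_rfl

/-- A linear functional vanishing on `p k * r` for the members `p j`, `j < k`, of a triangular
sequence vanishes on `p k * r` for all `r` of degree less than `k`. -/
theorem map_mul_eq_zero_of_natDegree_lt {p : ℕ → ℝ[X]} (hp0 : ∀ k, p k ≠ 0)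
    (hp : ∀ k, (p k).natDegree = k) (J : ℝ[X] →ₗ[ℝ] ℝ) {g : ℝ[X]} {k : ℕ}
    (h : ∀ j < k, J (g * p j) = 0) {q : ℝ[X]} (hq : q.degree < k) : J (g * q) = 0 := by
  rcases eq_or_ne q 0 with rfl | hq0
  · simp
  have hqk : q.natDegree < k := by
    rwa [degree_eq_natDegree hq0, Nat.cast_lt] at hq
  have hq := mem_span_of_natDegree_eq hp0 hp q
  have hle : Submodule.span ℝ (p '' Iic q.natDegree) ≤
      LinearMap.ker (J.comp (LinearMap.mulLeft ℝ g)) := by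
    rw [Submodule.span_le]
    rintro _ ⟨j, hj, rfl⟩
    simpa using h j (lt_of_le_of_lt hj hqk)
  simpa using hle hq

theorem weightedIntegral_monicOrthogonal_mul {w : ℝ → ℝ} {a b : ℝ} (hab : a < b)
    (hw : IntervalIntegrable w volume a b) (hpos : ∀ x ∈ Ioo a b, 0 < w x) {k : ℕ} {q : ℝ[X]}
    (hq : q.degree < k) : weightedIntegral w a b hw (monicOrthogonal w a b k * q) = 0 :=
  map_mul_eq_zero_of_natDegree_lt (fun k => (monicOrthogonal_isMonicOfDegree w a b k).monic.ne_zero)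
    (fun k => (monicOrthogonal_isMonicOfDegree w a b k).natDegree_eq) _
    (weightedInner_monicOrthogonal_of_lt hab hw hpos k) hq

theorem orthonormalPoly_natDegree {w : ℝ → ℝ} {a b : ℝ} (hab : a < b)
    (hw : IntervalIntegrable w volume a b) (hpos : ∀ x ∈ Ioo a b, 0 < w x) (k : ℕ) :
    (orthonormalPoly w a b k).natDegree = k := by
  have h := monicOrthogonal_isMonicOfDegree w a b k
  rw [orthonormalPoly, natDegree_C_mul, h.natDegree_eq]
  exact one_div_ne_zero (Real.sqrt_ne_zero'.2 (weightedInner_self_pos hab hw hpos h.monic.ne_zero))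

theorem orthonormalPoly_ne_zero {w : ℝ → ℝ} {a b : ℝ} (hab : a < b)
    (hw : IntervalIntegrable w volume a b) (hpos : ∀ x ∈ Ioo a b, 0 < w x) (k : ℕ) :
    orthonormalPoly w a b k ≠ 0 := by
  have h := monicOrthogonal_isMonicOfDegree w a b k
  refine mul_ne_zero (C_ne_zero.2 ?_) h.monic.ne_zero
  exact one_div_ne_zero (Real.sqrt_ne_zero'.2 (weightedInner_self_pos hab hw hpos h.monic.ne_zero))

theorem weightedIntegral_orthonormalPoly_mul {w : ℝ → ℝ} {a b : ℝ} (hab : a < b)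
    (hw : IntervalIntegrable w volume a b) (hpos : ∀ x ∈ Ioo a b, 0 < w x) {k : ℕ} {q : ℝ[X]}
    (hq : q.degree < k) : weightedIntegral w a b hw (orthonormalPoly w a b k * q) = 0 := by
  rw [orthonormalPoly, mul_assoc, ← smul_eq_C_mul, map_smul,
    weightedIntegral_monicOrthogonal_mul hab hw hpos hq, smul_zero]

theorem weightedIntegral_orthonormalPoly_mul_self {w : ℝ → ℝ} {a b : ℝ} (hab : a < b)
    (hw : IntervalIntegrable w volume a b) (hpos : ∀ x ∈ Ioo a b, 0 < w x) (k : ℕ) :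
    weightedIntegral w a b hw (orthonormalPoly w a b k * orthonormalPoly w a b k) = 1 := by
  have hs := weightedInner_self_pos hab hw hpos
    (monicOrthogonal_isMonicOfDegree w a b k).monic.ne_zero
  rw [orthonormalPoly, mul_mul_mul_comm, ← C_mul, ← smul_eq_C_mul, map_smul, ← weightedInner_eq,
    smul_eq_mul, ← mul_div_mul_comm, Real.mul_self_sqrt hs.le, mul_one, one_div,
    inv_mul_cancel₀ hs.ne']

theorem weightedIntegral_orthonormalPoly_mul_orthonormalPoly {w : ℝ → ℝ} {a b : ℝ} (hab : a < b)
    (hw : IntervalIntegrable w volume a b) (hpos : ∀ x ∈ Ioo a b, 0 < w x) (k l : ℕ) :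
    weightedIntegral w a b hw (orthonormalPoly w a b k * orthonormalPoly w a b l) =
      if k = l then 1 else 0 := by
  have hd : ∀ j, (orthonormalPoly w a b j).degree = j := fun j => by
    rw [degree_eq_natDegree (orthonormalPoly_ne_zero hab hw hpos j),
      orthonormalPoly_natDegree hab hw hpos]
  rcases lt_trichotomy k l with h | h | h
  · rw [if_neg h.ne, mul_comm]
    exact weightedIntegral_orthonormalPoly_mul hab hw hpos (by rw [hd]; exact_mod_cast h)
  · rw [if_pos h, h, weightedIntegral_orthonormalPoly_mul_self hab hw hpos]
  · rw [if_neg h.ne']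
    exact weightedIntegral_orthonormalPoly_mul hab hw hpos (by rw [hd]; exact_mod_cast h)

/-- Orthogonal polynomials do not vanish at the right end point of the interval. -/
theorem orthonormalPoly_eval_right_ne_zero {w : ℝ → ℝ} {a b : ℝ} (hab : a < b)
    (hw : IntervalIntegrable w volume a b) (hpos : ∀ x ∈ Ioo a b, 0 < w x) (k : ℕ) :
    (orthonormalPoly w a b k).eval b ≠ 0 := by
  intro h0
  have hne := orthonormalPoly_ne_zero hab hw hpos k
  -- If `b` were a zero, `p_k = (X - b) r` with `deg r < k`; then `p_k r = (X - b) r²` has a strict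
  -- sign inside the interval, although its weighted integral vanishes by orthogonality.
  obtain ⟨r, hr⟩ := dvd_iff_isRoot.2 h0
  have hr0 : r ≠ 0 := by rintro rfl; exact hne (by simpa using hr)
  have hdeg : r.degree < k := by
    have h1 := orthonormalPoly_natDegree hab hw hpos k
    rw [hr, natDegree_mul (X_sub_C_ne_zero b) hr0, natDegree_X_sub_C] at h1
    rw [degree_eq_natDegree hr0, Nat.cast_lt]
    omega
  have h1 := weightedIntegral_orthonormalPoly_mul hab hw hpos hdeg
  have h2 : 0 < weightedIntegral w a b hw (-(orthonormalPoly w a b k * r)) := by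
    refine weightedIntegral_pos hab hw hpos (fun x hx => ?_) (neg_ne_zero.2 (mul_ne_zero hne hr0))
    rw [hr]
    simp only [eval_neg, eval_mul, eval_sub, eval_X, eval_C]
    nlinarith [hx.2, mul_self_nonneg (r.eval x)]
  rw [map_neg, h1] at h2
  simp at h2

/-! ### Gegenbauer polynomials -/

theorem gegenbauer_recurrence (lam : ℝ) (k : ℕ) :
    C ((k : ℝ) + 2) * gegenbauer lam (k + 2) =
      C (2 * (k + 1 + lam)) * X * gegenbauer lam (k + 1) - C (k + 2 * lam) * gegenbauer lam k := by
  have h : ((k : ℝ) + 2) ≠ 0 := by positivity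
  rw [gegenbauer, mul_sub, ← mul_assoc, ← mul_assoc, ← mul_assoc, ← C_mul, ← C_mul,
    mul_div_cancel₀ _ h, mul_div_cancel₀ _ h]

/-- The two identities are proved together: differentiating the recurrence and inserting the first
identity at `k` gives the second at `k + 1`, and the first at `k + 1` then follows from the
undifferentiated recurrence. -/
theorem gegenbauer_derivative_identities (lam : ℝ) (k : ℕ) :
    X * derivative (gegenbauer lam (k + 1)) - derivative (gegenbauer lam k) =
        C ((k : ℝ) + 1) * gegenbauer lam (k + 1) ∧
      derivative (gegenbauer lam (k + 1)) - X * derivative (gegenbauer lam k) =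
        C (k + 2 * lam) * gegenbauer lam k := by
  induction k with
  | zero => simp [gegenbauer, mul_comm X]
  | succ k ih =>
    obtain ⟨hA, hB⟩ := ih
    have hrec := gegenbauer_recurrence lam k
    have hd := congrArg derivative hrec
    simp only [derivative_mul, derivative_sub, derivative_C, derivative_X, zero_mul, zero_add,
      mul_one] at hd
    have hk : C ((k : ℝ) + 2) ≠ 0 := C_ne_zero.2 (by positivity)
    have hB' : derivative (gegenbauer lam (k + 2)) - X * derivative (gegenbauer lam (k + 1)) =
        C (((k + 1 : ℕ) : ℝ) + 2 * lam) * gegenbauer lam (k + 1) := by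
      refine mul_left_cancel₀ hk ?_
      push_cast
      simp only [map_add, map_mul, map_natCast, map_one, map_ofNat] at hd hA ⊢
      linear_combination hd + ((k : ℝ[X]) + 2 * C lam) * hA
    refine ⟨?_, hB'⟩
    push_cast at hB' ⊢
    simp only [map_add, map_mul, map_natCast, map_one, map_ofNat] at hrec hA hB hB' ⊢
    linear_combination X * hB' + X * hA - hB - hrec

theorem one_sub_sq_mul_derivative_gegenbauer (lam : ℝ) (k : ℕ) :
    (1 - X ^ 2) * derivative (gegenbauer lam (k + 1)) =
      C (k + 2 * lam) * gegenbauer lam k - C ((k : ℝ) + 1) * X * gegenbauer lam (k + 1) := by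
  obtain ⟨hA, hB⟩ := gegenbauer_derivative_identities lam k
  linear_combination hB - X * hA

/-- Differentiate the first-order relation above and eliminate the derivative of the lower
polynomial with the first derivative identity. -/
theorem gegenbauer_differential_equation (lam : ℝ) (k : ℕ) :
    (1 - X ^ 2) * derivative (derivative (gegenbauer lam k)) -
      C (2 * lam + 1) * X * derivative (gegenbauer lam k) =
      - C (k * (k + 2 * lam)) * gegenbauer lam k := by
  cases k with
  | zero => simp [gegenbauer]
  | succ k =>
    have hE := congrArg derivative (one_sub_sq_mul_derivative_gegenbauer lam k)
    have hA := (gegenbauer_derivative_identities lam k).1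
    simp only [derivative_mul, derivative_sub, derivative_C, derivative_X, derivative_X_pow,
      derivative_one, zero_mul, zero_add, mul_one] at hE
    push_cast at hE ⊢
    simp only [map_add, map_mul, map_natCast, map_one, map_ofNat] at hE hA ⊢
    linear_combination hE - ((k : ℝ[X]) + 2 * C lam) * hA

theorem gegenbauer_eval_one_succ (lam : ℝ) (k : ℕ) :
    ((k : ℝ) + 1) * (gegenbauer lam (k + 1)).eval 1 =
      (k + 2 * lam) * (gegenbauer lam k).eval 1 := by
  have h := congrArg (eval 1) (one_sub_sq_mul_derivative_gegenbauer lam k)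
  simp at h
  linarith

theorem gegenbauer_eval_one_pos {lam : ℝ} (hlam : 0 < lam) (k : ℕ) :
    0 < (gegenbauer lam k).eval 1 := by
  induction k with
  | zero => simp [gegenbauer]
  | succ k ih =>
    have h := gegenbauer_eval_one_succ lam k
    have h1 : 0 < ((k : ℝ) + 1) * (gegenbauer lam (k + 1)).eval 1 := by
      rw [h]; positivity
    exact pos_of_mul_pos_right h1 (by positivity)

theorem gegenbauer_natDegree_le_and_coeff_pos {lam : ℝ} (hlam : 0 < lam) (k : ℕ) :
    (gegenbauer lam k).natDegree ≤ k ∧ 0 < (gegenbauer lam k).coeff k := by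
  induction k using Nat.twoStepInduction with
  | zero => simp [gegenbauer]
  | one =>
    refine ⟨?_, by simpa [gegenbauer] using hlam⟩
    exact (natDegree_C_mul_le _ _).trans natDegree_X_le
  | more k ih1 ih2 =>
    rw [gegenbauer]
    constructor
    · refine (natDegree_sub_le _ _).trans (max_le ?_ ?_)
      · rw [mul_assoc]
        refine (natDegree_C_mul_le _ _).trans (natDegree_mul_le.trans ?_)
        have := natDegree_X_le (R := ℝ)
        omega
      · exact (natDegree_C_mul_le _ _).trans (by omega)
    · rw [coeff_sub, mul_assoc, coeff_C_mul, coeff_C_mul, coeff_X_mul,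
        coeff_eq_zero_of_natDegree_lt (p := gegenbauer lam k) (by omega), mul_zero, sub_zero]
      have := ih2.2
      positivity

theorem gegenbauer_natDegree {lam : ℝ} (hlam : 0 < lam) (k : ℕ) :
    (gegenbauer lam k).natDegree = k :=
  let h := gegenbauer_natDegree_le_and_coeff_pos hlam k
  natDegree_eq_of_le_of_coeff_ne_zero h.1 h.2.ne'

theorem gegenbauer_ne_zero {lam : ℝ} (hlam : 0 < lam) (k : ℕ) : gegenbauer lam k ≠ 0 := by
  intro h
  simpa [h] using gegenbauer_eval_one_pos hlam k

theorem intervalIntegrable_one_sub_sq_rpow {μ : ℝ} (hμ : 0 ≤ μ) :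
    IntervalIntegrable (fun s : ℝ => (1 - s ^ 2) ^ μ) volume (-1) 1 :=
  (Continuous.rpow_const (by fun_prop) fun _ => Or.inr hμ).intervalIntegrable _ _

/-- The functional `p ↦ ∫ p(t) (1 - t²)^μ dt` over `[-1, 1]`. -/
def gegenbauerIntegral (μ : ℝ) (hμ : 0 ≤ μ) : ℝ[X] →ₗ[ℝ] ℝ :=
  weightedIntegral (fun s : ℝ => (1 - s ^ 2) ^ μ) (-1) 1 (intervalIntegrable_one_sub_sq_rpow hμ)

theorem gegenbauerIntegral_apply {μ : ℝ} (hμ : 0 ≤ μ) (p : ℝ[X]) :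
    gegenbauerIntegral μ hμ p = ∫ s in (-1 : ℝ)..1, p.eval s * (1 - s ^ 2) ^ μ := rfl

/-- The integrand is the derivative of `f(s) (1 - s²)^(μ + 1)`, which vanishes at both end points.
Stated this way, it serves as integration by parts for polynomials. -/
theorem gegenbauerIntegral_divergence {μ : ℝ} (hμ : 0 ≤ μ) (f : ℝ[X]) :
    gegenbauerIntegral μ hμ ((1 - X ^ 2) * derivative f - C (2 * (μ + 1)) * X * f) = 0 := by
  have hF : ∀ x ∈ uIcc (-1 : ℝ) 1, HasDerivAt (fun s : ℝ => f.eval s * (1 - s ^ 2) ^ (μ + 1))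
      (((1 - X ^ 2) * derivative f - C (2 * (μ + 1)) * X * f).eval x * (1 - x ^ 2) ^ μ) x := by
    intro x hx
    rw [uIcc_of_le (by norm_num)] at hx
    have h0 : 0 ≤ 1 - x ^ 2 := by nlinarith [hx.1, hx.2]
    have h1 : HasDerivAt (fun s : ℝ => 1 - s ^ 2) (-(2 * x)) x := by
      simpa using (hasDerivAt_pow 2 x).const_sub 1
    have h2 := h1.rpow_const (p := μ + 1) (Or.inr (by linarith))
    refine ((f.hasDerivAt x).mul h2).congr_deriv ?_
    rw [add_sub_cancel_right, Real.rpow_add_of_nonneg h0 hμ zero_le_one, Real.rpow_one]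
    simp only [eval_sub, eval_mul, eval_one, eval_pow, eval_X, eval_C]
    ring
  rw [gegenbauerIntegral_apply, intervalIntegral.integral_eq_sub_of_hasDerivAt hF
    (intervalIntegrable_eval_mul (intervalIntegrable_one_sub_sq_rpow hμ) _)]
  have : μ + 1 ≠ 0 := by positivity
  simp [Real.zero_rpow this]

/-- The Sturm–Liouville form of the differential equation. For `g` another Gegenbauer polynomial the
right side is symmetric, so distinct eigenvalues `k (k + 2 lam)` force orthogonality. -/
theorem gegenbauerIntegral_gegenbauer_mul {μ : ℝ} (hμ : 0 ≤ μ) (k : ℕ) (g : ℝ[X]) :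
    k * (k + 2 * (μ + 1 / 2)) * gegenbauerIntegral μ hμ (gegenbauer (μ + 1 / 2) k * g) =
      gegenbauerIntegral μ hμ
        ((1 - X ^ 2) * derivative (gegenbauer (μ + 1 / 2) k) * derivative g) := by
  have h1 := gegenbauerIntegral_divergence hμ (derivative (gegenbauer (μ + 1 / 2) k) * g)
  have h2 := gegenbauer_differential_equation (μ + 1 / 2) k
  rw [← smul_eq_mul, ← map_smul, ← sub_eq_zero, ← map_sub, ← neg_eq_zero, ← map_neg, ← h1]
  congr 1
  rw [smul_eq_C_mul, derivative_mul]
  have h3 : C (2 * (μ + 1 / 2) + 1) = C (2 * (μ + 1)) := by congr 1; ring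
  rw [h3] at h2
  linear_combination (-g) * h2

theorem gegenbauerIntegral_gegenbauer_mul_gegenbauer {μ : ℝ} (hμ : 0 ≤ μ) {k j : ℕ}
    (hkj : k ≠ j) : gegenbauerIntegral μ hμ
      (gegenbauer (μ + 1 / 2) k * gegenbauer (μ + 1 / 2) j) = 0 := by
  have h1 := gegenbauerIntegral_gegenbauer_mul hμ k (gegenbauer (μ + 1 / 2) j)
  have h2 := gegenbauerIntegral_gegenbauer_mul hμ j (gegenbauer (μ + 1 / 2) k)
  rw [mul_comm (gegenbauer _ j), mul_right_comm (1 - X ^ 2), ← h1, ← sub_eq_zero, ← sub_mul] at h2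
  refine (mul_eq_zero.1 h2).resolve_left ?_
  have h3 : (j : ℝ) * (j + 2 * (μ + 1 / 2)) - k * (k + 2 * (μ + 1 / 2)) =
      ((j : ℝ) - k) * (j + k + 2 * μ + 1) := by ring
  rw [h3]
  refine mul_ne_zero (sub_ne_zero.2 (by exact_mod_cast hkj.symm)) (by positivity)

theorem gegenbauerIntegral_gegenbauer_mul_of_degree_lt {μ : ℝ} (hμ : 0 ≤ μ) {k : ℕ} {q : ℝ[X]}
    (hq : q.degree < k) : gegenbauerIntegral μ hμ (gegenbauer (μ + 1 / 2) k * q) = 0 :=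
  map_mul_eq_zero_of_natDegree_lt (gegenbauer_ne_zero (by positivity))
    (gegenbauer_natDegree (by positivity)) _
    (fun _ hj => gegenbauerIntegral_gegenbauer_mul_gegenbauer hμ hj.ne') hq

/-- The mixed integral `∫ t C_{k+1} C_k` is computed twice: from the recurrence for `C_{k+2}` tested
against `C_k`, and from the one for `C_{k+1}` tested against `C_{k+1}`. Eliminating it relates
consecutive norms. -/
theorem gegenbauerIntegral_gegenbauer_mul_self_succ {μ : ℝ} (hμ : 0 ≤ μ) (k : ℕ) :
    (k + 1 + (μ + 1 / 2)) * (k + 1) * gegenbauerIntegral μ hμ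
      (gegenbauer (μ + 1 / 2) (k + 1) * gegenbauer (μ + 1 / 2) (k + 1)) =
    (k + (μ + 1 / 2)) * (k + 2 * (μ + 1 / 2)) * gegenbauerIntegral μ hμ
      (gegenbauer (μ + 1 / 2) k * gegenbauer (μ + 1 / 2) k) := by
  have hort : ∀ i j, i ≠ j → _ := fun i j h =>
    gegenbauerIntegral_gegenbauer_mul_gegenbauer hμ (k := i) (j := j) h
  set lam := μ + 1 / 2 with hlam
  set J := gegenbauerIntegral μ hμ with hJ
  have hx : 2 * (k + 1 + lam) * J (X * gegenbauer lam (k + 1) * gegenbauer lam k) =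
      (k + 2 * lam) * J (gegenbauer lam k * gegenbauer lam k) := by
    have h := congrArg (fun p => J (p * gegenbauer lam k)) (gegenbauer_recurrence lam k)
    simp only [sub_mul, mul_assoc, map_sub] at h
    simp only [← smul_eq_C_mul, map_smul, smul_eq_mul] at h
    rw [hort (k + 2) k (by omega)] at h
    simp only [mul_assoc]
    linarith
  have hy : (k + 1) * J (gegenbauer lam (k + 1) * gegenbauer lam (k + 1)) =
      2 * (k + lam) * J (X * gegenbauer lam (k + 1) * gegenbauer lam k) := by
    -- The recurrence only begins at `C_2`, so `C_1 = 2 lam X` is treated by hand.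
    cases k with
    | zero =>
      have h : gegenbauer lam 1 * gegenbauer lam 1 = (2 * lam) • (X * gegenbauer lam 1) := by
        simp [gegenbauer, smul_eq_C_mul]; ring
      simp only [zero_add, h, map_smul, smul_eq_mul]
      simp [gegenbauer]
    | succ k =>
      have h := congrArg (fun p => J (p * gegenbauer lam (k + 2))) (gegenbauer_recurrence lam k)
      simp only [sub_mul, mul_assoc, map_sub] at h
      simp only [← smul_eq_C_mul, map_smul, smul_eq_mul] at h
      rw [hort k (k + 2) (by omega)] at h
      rw [mul_comm (gegenbauer lam (k + 1))] at h
      push_cast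
      simp only [mul_assoc]
      linarith
  linear_combination (k + 1 + lam) * hy + (k + lam) * hx

/-- The squared norm of the Gegenbauer polynomials, relative to their value at `1`. -/
theorem gegenbauerIntegral_gegenbauer_mul_self {μ : ℝ} (hμ : 0 ≤ μ) (k : ℕ) :
    (k + (μ + 1 / 2)) * gegenbauerIntegral μ hμ
      (gegenbauer (μ + 1 / 2) k * gegenbauer (μ + 1 / 2) k) =
    (μ + 1 / 2) * gegenbauerIntegral μ hμ 1 * (gegenbauer (μ + 1 / 2) k).eval 1 := by
  induction k with
  | zero => simp [gegenbauer]
  | succ k ih =>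
    have h1 := gegenbauerIntegral_gegenbauer_mul_self_succ hμ k
    have h2 := gegenbauer_eval_one_succ (μ + 1 / 2) k
    have hk : ((k : ℝ) + 1) ≠ 0 := by positivity
    refine mul_left_cancel₀ hk ?_
    push_cast
    linear_combination h1 + (k + 2 * (μ + 1 / 2)) * ih -
      (μ + 1 / 2) * gegenbauerIntegral μ hμ 1 * h2

/-! ### Gaussian quadrature at the zeros of a quasi-orthogonal polynomial -/

/-- The interpolatory quadrature formula at the zeros of `C_{n+1} + a C_n` is exact on polynomials
of degree at most `2 n`. -/
theorem sum_quadWeight_mul_eval {μ : ℝ} (hμ : 0 ≤ μ) {n : ℕ} {a : ℝ} {t : Fin (n + 1) → ℝ}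
    (ht_inj : Function.Injective t)
    (ht_root : ∀ j, (gegenbauer (μ + 1 / 2) (n + 1) +
      C a * gegenbauer (μ + 1 / 2) n).eval (t j) = 0) {p : ℝ[X]} (hp : p.natDegree ≤ 2 * n) :
    ∑ j, quadWeight μ t j * p.eval (t j) = gegenbauerIntegral μ hμ p := by
  set G := gegenbauer (μ + 1 / 2) (n + 1) + C a * gegenbauer (μ + 1 / 2) n with hG
  have hlam : 0 < μ + 1 / 2 := by positivity
  have hGdeg : G.natDegree = n + 1 := by
    rw [hG, natDegree_add_eq_left_of_natDegree_lt, gegenbauer_natDegree hlam]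
    refine (natDegree_C_mul_le _ _).trans_lt ?_
    rw [gegenbauer_natDegree hlam, gegenbauer_natDegree hlam]
    exact n.lt_succ_self
  have hG0 : G ≠ 0 := by rintro h; simp [h] at hGdeg
  -- The quotient has degree below `n`, hence is orthogonal to both `C_{n+1}` and `C_n`. The term `a
  -- C_n` thus costs just one degree of exactness compared with Gauss quadrature.
  have hJG : gegenbauerIntegral μ hμ (G * (p / G)) = 0 := by
    rcases eq_or_ne (p / G) 0 with h0 | h0
    · simp [h0]
    have hd : (p / G).degree < n := by
      have hle : G.degree ≤ p.degree := not_lt.1 fun h => h0 ((Polynomial.div_eq_zero_iff hG0).2 h)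
      have hp0 : p ≠ 0 := by rintro rfl; simp at h0
      have h := degree_add_div hG0 hle
      rw [degree_eq_natDegree h0, degree_eq_natDegree hG0, degree_eq_natDegree hp0,
        ← Nat.cast_add, Nat.cast_inj] at h
      rw [degree_eq_natDegree h0, Nat.cast_lt]
      omega
    have hdec : G * (p / G) = gegenbauer (μ + 1 / 2) (n + 1) * (p / G) +
        a • (gegenbauer (μ + 1 / 2) n * (p / G)) := by
      rw [smul_eq_C_mul]; ring
    rw [hdec, map_add, map_smul, gegenbauerIntegral_gegenbauer_mul_of_degree_lt hμ hd,
      gegenbauerIntegral_gegenbauer_mul_of_degree_lt hμ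
        (hd.trans (by exact_mod_cast n.lt_succ_self))]
    simp
  -- The remainder agrees with `p` at the nodes and has degree at most `n`, so Lagrange
  -- interpolation recovers it exactly.
  have hmod : (p % G).degree < (Finset.univ : Finset (Fin (n + 1))).card := by
    have := EuclideanDomain.mod_lt p hG0
    rw [Finset.card_fin]
    refine this.trans_le ?_
    rw [degree_eq_natDegree hG0, hGdeg]
  have heval : ∀ j, p.eval (t j) = (p % G).eval (t j) := fun j => by
    conv_lhs => rw [← EuclideanDomain.div_add_mod p G]
    simp [ht_root j]
  have hint := Lagrange.eq_interpolate (ht_inj.injOn (s := (Finset.univ : Finset (Fin (n + 1)))))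
    hmod
  rw [Lagrange.interpolate_apply] at hint
  conv_rhs => rw [← EuclideanDomain.div_add_mod p G, map_add, hJG, zero_add, hint, map_sum]
  refine Finset.sum_congr rfl fun j _ => ?_
  rw [← smul_eq_C_mul, map_smul, heval, smul_eq_mul, mul_comm]
  rfl

/-! ### Chebyshev–Gauss quadrature on `[0, L]` -/

/-- The affine map `z ↦ 2 z / L - 1` carries `[0, L]` to `[-1, 1]`; this form matches the Chebyshev
weight used in `Polynomial.Chebyshev.integral_measureT`. -/
theorem chebyshevWeight_eq {L : ℝ} (hL : 0 < L) (z : ℝ) :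
    chebyshevWeight L z = 2 / (Real.pi * L) * √(1 - (2 / L * z + -1) ^ 2)⁻¹ := by
  have h : z * (L - z) = (L / 2) ^ 2 * (1 - (2 / L * z + -1) ^ 2) := by
    field_simp; ring
  rw [chebyshevWeight, h, Real.sqrt_mul (sq_nonneg _), Real.sqrt_sq (by positivity), Real.sqrt_inv]
  rw [one_div, mul_inv, mul_inv]
  field_simp

theorem chebyshevWeight_pos {L : ℝ} {z : ℝ} (hz : z ∈ Ioo 0 L) : 0 < chebyshevWeight L z := by
  have : 0 < z * (L - z) := mul_pos hz.1 (sub_pos.2 hz.2)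
  rw [chebyshevWeight]
  have := Real.sqrt_pos.2 this
  have := Real.pi_pos
  positivity

theorem intervalIntegrable_chebyshevWeight {L : ℝ} (hL : 0 < L) :
    IntervalIntegrable (chebyshevWeight L) volume 0 L := by
  have h1 := Polynomial.Chebyshev.intervalIntegrable_sqrt_one_sub_sq_inv
  have h2 := (h1.comp_add_right (-1)).comp_mul_left (c := 2 / L)
  have h3 := h2.const_mul (2 / (Real.pi * L))
  have e1 : (-1 - -1) / (2 / L) = 0 := by simp
  have e2 : (1 - -1) / (2 / L) = L := by field_simp; norm_num
  rw [e1, e2] at h3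
  exact h3.congr fun z _ => (chebyshevWeight_eq hL z).symm

/-- The functional `p ↦ ∫ p W_L` over `[0, L]`. -/
def chebyshevIntegral (L : ℝ) (hL : 0 < L) : ℝ[X] →ₗ[ℝ] ℝ :=
  weightedIntegral (chebyshevWeight L) 0 L (intervalIntegrable_chebyshevWeight hL)

/-- Chebyshev–Gauss quadrature with `n + 1` nodes, transported by `z = L / 2 * (1 + x)`. Its weights
are all equal, which is why a plain sum appears; degree `2 n` is all that products of two
polynomials of degree at most `n` require. -/
theorem sum_eval_zNode {L : ℝ} (hL : 0 < L) {n : ℕ} {p : ℝ[X]} (hp : p.natDegree ≤ 2 * n) :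
    ∑ i, p.eval (zNode L n i) = (n + 1) * chebyshevIntegral L hL p := by
  set q : ℝ[X] := p.comp (C (L / 2) * (1 + X)) with hq
  have hqdeg : q.natDegree ≤ 2 * n := by
    refine natDegree_comp_le.trans ((Nat.mul_le_mul hp ?_).trans (mul_one _).le)
    refine (natDegree_C_mul_le _ _).trans ((natDegree_add_le _ _).trans ?_)
    simp
  have hqeval : ∀ x, q.eval x = p.eval (L / 2 * (1 + x)) := fun x => by simp [hq]
  have hgauss := Polynomial.Chebyshev.integral_eq_sumZeroes (n := n + 1) (P := q) n.succ_ne_zero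
    (by
      refine degree_le_natDegree.trans_lt ?_
      have : q.natDegree < 2 * (n + 1) := by omega
      exact_mod_cast this)
  have hint : ∫ x, q.eval x ∂Polynomial.Chebyshev.measureT =
      Real.pi * chebyshevIntegral L hL p := by
    rw [Polynomial.Chebyshev.integral_measureT, chebyshevIntegral, weightedIntegral_apply]
    have hsub := intervalIntegral.integral_comp_mul_add (a := 0) (b := L)
      (fun x => q.eval x * √(1 - x ^ 2)⁻¹) (c := 2 / L) (by positivity) (-1)
    have e1 : 2 / L * 0 + -1 = -1 := by simp
    have e2 : 2 / L * L + -1 = 1 := by field_simp; norm_num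
    rw [e1, e2, smul_eq_mul, inv_div] at hsub
    have hL0 := hL.ne'
    have e3 : ∀ z, p.eval z * chebyshevWeight L z = 2 / (Real.pi * L) *
        (q.eval (2 / L * z + -1) * √(1 - (2 / L * z + -1) ^ 2)⁻¹) := fun z => by
      rw [chebyshevWeight_eq hL, hqeval]
      have : L / 2 * (1 + (2 / L * z + -1)) = z := by field_simp; ring
      rw [this]; ring
    simp only [e3]
    rw [intervalIntegral.integral_const_mul, hsub]
    have := Real.pi_pos.ne'
    field_simp
  rw [hint, Polynomial.Chebyshev.sumZeroes, Finset.sum_range] at hgauss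
  have hsum : ∑ i, p.eval (zNode L n i) =
      ∑ i : Fin (n + 1), q.eval (Real.cos ((2 * (i : ℕ) + 1) / (2 * (n + 1 : ℕ)) * Real.pi)) := by
    refine Finset.sum_congr rfl fun i _ => ?_
    rw [hqeval, zNode]
    congr 4
    push_cast
    rw [mul_add, mul_one]
    ring
  rw [hsum]
  have := Real.pi_pos.ne'
  have hn : ((n + 1 : ℕ) : ℝ) ≠ 0 := by positivity
  rw [div_mul_eq_mul_div, eq_div_iff hn, mul_assoc] at hgauss
  have hgauss' := mul_left_cancel₀ this hgauss
  rw [← hgauss', mul_comm]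
  push_cast
  rfl

theorem axialOrthonormal_natDegree {L : ℝ} (hL : 0 < L) (k : ℕ) :
    (axialOrthonormal L k).natDegree = k :=
  orthonormalPoly_natDegree hL (intervalIntegrable_chebyshevWeight hL)
    (fun _ => chebyshevWeight_pos) k

theorem axialOrthonormal_ne_zero {L : ℝ} (hL : 0 < L) (k : ℕ) : axialOrthonormal L k ≠ 0 :=
  orthonormalPoly_ne_zero hL (intervalIntegrable_chebyshevWeight hL)
    (fun _ => chebyshevWeight_pos) k

/-- Discrete orthonormality of the axial polynomials on the Chebyshev–Gauss nodes. -/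
theorem sum_axialOrthonormal_mul_axialOrthonormal {L : ℝ} (hL : 0 < L) {n k l : ℕ} (hk : k ≤ n)
    (hl : l ≤ n) : ∑ i, (axialOrthonormal L k).eval (zNode L n i) *
      (axialOrthonormal L l).eval (zNode L n i) = if k = l then (n : ℝ) + 1 else 0 := by
  have h := sum_eval_zNode hL (n := n) (p := axialOrthonormal L k * axialOrthonormal L l)
    (natDegree_mul_le.trans (by
      rw [axialOrthonormal_natDegree hL, axialOrthonormal_natDegree hL]; omega))
  simp only [eval_mul] at h
  rw [h, chebyshevIntegral, axialOrthonormal, axialOrthonormal,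
    weightedIntegral_orthonormalPoly_mul_orthonormalPoly hL _ fun _ => chebyshevWeight_pos]
  simp

theorem zNode_mem {L : ℝ} (hL : 0 < L) (n : ℕ) (i : Fin (n + 1)) :
    0 ≤ zNode L n i ∧ zNode L n i ≤ L := by
  rw [zNode]
  set c := Real.cos ((2 * (i : ℝ) + 1) * Real.pi / (2 * (n : ℝ) + 2))
  have h1 : -1 ≤ c := Real.neg_one_le_cos _
  have h2 : c ≤ 1 := Real.cos_le_one _
  constructor <;> nlinarith

/-! ### Equally spaced angles -/

/-- A geometric sum whose ratio is an `(n + 1)`-th root of unity, different from `1` because `n + 1`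
cannot divide `j` when `0 < |j| ≤ n`. -/
theorem sum_exp_angle {n : ℕ} {j : ℤ} (hj0 : j ≠ 0) (hj : |j| ≤ n) :
    ∑ ν : Fin (n + 1), Complex.exp ((2 * j * angle n ν : ℝ) * Complex.I) = 0 := by
  set z : ℂ := Complex.exp ((2 * j * (Real.pi / (n + 1)) : ℝ) * Complex.I) with hz
  have hn : ((n : ℂ) + 1) ≠ 0 := by exact_mod_cast n.succ_ne_zero
  have hpow : ∀ ν : Fin (n + 1), Complex.exp ((2 * j * angle n ν : ℝ) * Complex.I) = z ^ (ν : ℕ) :=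
    fun ν => by
      rw [hz, ← Complex.exp_nat_mul, angle]
      congr 1
      push_cast
      ring
  have hz1 : z ≠ 1 := by
    intro h
    obtain ⟨N, hN⟩ := Complex.exp_eq_one_iff.1 h
    have hpi : (Real.pi : ℂ) ≠ 0 := by exact_mod_cast Real.pi_pos.ne'
    have h1 : (j : ℂ) = N * (n + 1) := by
      push_cast at hN
      field_simp at hN
      linear_combination hN
    have h2 : j = N * (n + 1) := by exact_mod_cast h1
    have hN0 : N ≠ 0 := by rintro rfl; simp at h2; exact hj0 h2
    have h3 : (1 : ℤ) ≤ |N| := Int.one_le_abs hN0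
    rw [h2, abs_mul, abs_of_nonneg (by positivity : (0 : ℤ) ≤ (n : ℤ) + 1)] at hj
    nlinarith
  have hzn : z ^ (n + 1) = 1 := by
    rw [hz, ← Complex.exp_nat_mul, Complex.exp_eq_one_iff]
    refine ⟨j, ?_⟩
    push_cast
    field_simp
  simp_rw [hpow]
  rw [Fin.sum_univ_eq_sum_range (fun i => z ^ i), geom_sum_eq hz1, hzn, sub_self, zero_div]

theorem sum_cos_angle {n : ℕ} {j : ℤ} (hj : |j| ≤ n) :
    ∑ ν : Fin (n + 1), Real.cos (2 * j * angle n ν) = if j = 0 then (n : ℝ) + 1 else 0 := by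
  split_ifs with h
  · simp [h]
  · have := congrArg Complex.re (sum_exp_angle h hj)
    simpa only [Complex.re_sum, Complex.exp_ofReal_mul_I_re, Complex.zero_re] using this

theorem sum_sin_angle {n : ℕ} {j : ℤ} (hj : |j| ≤ n) :
    ∑ ν : Fin (n + 1), Real.sin (2 * j * angle n ν) = 0 := by
  rcases eq_or_ne j 0 with h | h
  · simp [h]
  · have := congrArg Complex.im (sum_exp_angle h hj)
    simpa only [Complex.im_sum, Complex.exp_ofReal_mul_I_im, Complex.zero_im] using this

theorem angular_cos_sin (ε : Fin 2) (m : ℕ) (ξ : ℝ) :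
    angular ε m (Real.cos ξ) (Real.sin ξ) =
      if ε = 0 then Real.cos (m * ξ) else Real.sin (m * ξ) := by
  have h : ((Real.cos ξ : ℂ) + Real.sin ξ * Complex.I) ^ m =
      Complex.exp ((m * ξ : ℝ) * Complex.I) := by
    rw [Complex.ofReal_cos, Complex.ofReal_sin, ← Complex.exp_mul_I, ← Complex.exp_nat_mul]
    push_cast
    ring_nf
  rw [angular, h, Complex.exp_ofReal_mul_I_re, Complex.exp_ofReal_mul_I_im]

/-- Equal parity makes `m + m'` and `m - m'` even, say `2 j` and `2 i`. The product formulas then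
involve only the frequencies `2 j` and `2 i`, with `|j|, |i| ≤ n`, for which equally spaced angles
on a half circle suffice. -/
theorem sum_angular_mul_angular {n m m' : ℕ} (hmm : m ≤ n) (hmm' : m' ≤ n)
    (hpar : m % 2 = m' % 2) (ε ε' : Fin 2) :
    ∑ ν : Fin (n + 1), angular ε m (Real.cos (angle n ν)) (Real.sin (angle n ν)) *
      angular ε' m' (Real.cos (angle n ν)) (Real.sin (angle n ν)) =
    if m = m' ∧ ε = ε' then (if m = 0 then (if ε = 0 then (n : ℝ) + 1 else 0) else (n + 1) / 2)
      else 0 := by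
  obtain ⟨j, hj⟩ : ∃ j : ℤ, (m : ℤ) + m' = 2 * j := ⟨((m : ℤ) + m') / 2, by omega⟩
  obtain ⟨i, hi⟩ : ∃ i : ℤ, (m : ℤ) - m' = 2 * i := ⟨((m : ℤ) - m') / 2, by omega⟩
  have hja : |j| ≤ n := abs_le.2 ⟨by omega, by omega⟩
  have hia : |i| ≤ n := abs_le.2 ⟨by omega, by omega⟩
  have hm : (m : ℝ) = j + i := by
    have : (m : ℤ) = j + i := by omega
    exact_mod_cast this
  have hm' : (m' : ℝ) = j - i := by
    have : (m' : ℤ) = j - i := by omega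
    exact_mod_cast this
  have hm0 : m = 0 ∧ m' = 0 ↔ j = 0 := by omega
  have hmi : m = m' ↔ i = 0 := by omega
  have cj := sum_cos_angle hja
  have ci := sum_cos_angle hia
  have sj := sum_sin_angle hja
  have si := sum_sin_angle hia
  have e1 : ∀ x : ℝ, (j + i : ℝ) * x = j * x + i * x := fun x => by ring
  have e2 : ∀ x : ℝ, (j - i : ℝ) * x = j * x - i * x := fun x => by ring
  have t1 : ∀ x y : ℝ, Real.cos (x + y) * Real.cos (x - y) =
      (Real.cos (2 * x) + Real.cos (2 * y)) / 2 := fun x y => by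
    rw [Real.cos_add, Real.cos_sub, Real.cos_two_mul, Real.cos_two_mul]
    nlinarith [Real.sin_sq_add_cos_sq x, Real.sin_sq_add_cos_sq y]
  have t2 : ∀ x y : ℝ, Real.sin (x + y) * Real.sin (x - y) =
      (Real.cos (2 * y) - Real.cos (2 * x)) / 2 := fun x y => by
    rw [Real.sin_add, Real.sin_sub, Real.cos_two_mul, Real.cos_two_mul]
    nlinarith [Real.sin_sq_add_cos_sq x, Real.sin_sq_add_cos_sq y]
  have t3 : ∀ x y : ℝ, Real.sin (x + y) * Real.cos (x - y) =
      (Real.sin (2 * x) + Real.sin (2 * y)) / 2 := fun x y => by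
    rw [Real.sin_add, Real.cos_sub, Real.sin_two_mul, Real.sin_two_mul]
    linear_combination Real.sin x * Real.cos x * Real.sin_sq_add_cos_sq y +
      Real.sin y * Real.cos y * Real.sin_sq_add_cos_sq x
  have t4 : ∀ x y : ℝ, Real.cos (x + y) * Real.sin (x - y) =
      (Real.sin (2 * x) - Real.sin (2 * y)) / 2 := fun x y => by
    rw [Real.sin_sub, Real.cos_add, Real.sin_two_mul, Real.sin_two_mul]
    linear_combination Real.sin x * Real.cos x * Real.sin_sq_add_cos_sq y -
      Real.sin y * Real.cos y * Real.sin_sq_add_cos_sq x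
  simp only [angular_cos_sin, hm, hm', e1, e2]
  fin_cases ε <;> fin_cases ε' <;>
    simp only [Fin.zero_eta, Fin.mk_one, if_true, Fin.isValue, one_ne_zero, if_false, t1, t2, t3,
      t4, ← Finset.sum_div, Finset.sum_add_distrib, Finset.sum_sub_distrib, ← mul_assoc, cj, ci,
      sj, si, zero_ne_one, and_false, and_true, add_zero, sub_zero, zero_div, hmi]
  · by_cases hi0 : i = 0
    · by_cases hj0 : j = 0
      · rw [if_pos hj0, if_pos hi0, if_pos hi0, if_pos (hm0.2 hj0).1]; ring
      · rw [if_neg hj0, if_pos hi0, if_pos hi0, if_neg (by omega)]; ring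
    · have hj0 : j ≠ 0 := by omega
      simp [hi0, hj0]
  · by_cases hi0 : i = 0
    · by_cases hj0 : j = 0
      · rw [if_pos hj0, if_pos hi0, if_pos hi0, if_pos (hm0.2 hj0).1]; simp
      · rw [if_neg hj0, if_pos hi0, if_pos hi0, if_neg (by omega)]; ring
    · have hj0 : j ≠ 0 := by omega
      simp [hi0, hj0]

/-! ### The angular kernel -/

theorem intervalIntegrable_jacobi {α β : ℝ} (hα : -1 < α) (hβ : 0 ≤ β) :
    IntervalIntegrable (fun s : ℝ => (1 - s) ^ α * (1 + s) ^ β) volume (-1) 1 := by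
  have h1 : IntervalIntegrable (fun s : ℝ => (1 - s) ^ α) volume (-1) 1 := by
    have := (intervalIntegral.intervalIntegrable_rpow' (a := 0) (b := 2) hα).comp_sub_left 1
    norm_num at this
    exact this.symm
  exact h1.mul_continuousOn
    (Continuous.rpow_const (by fun_prop) fun _ => Or.inr hβ).continuousOn

theorem jacobi_pos {α β s : ℝ} (hs : s ∈ Ioo (-1 : ℝ) 1) : 0 < (1 - s) ^ α * (1 + s) ^ β :=
  mul_pos (Real.rpow_pos_of_pos (by linarith [hs.2]) _)
    (Real.rpow_pos_of_pos (by linarith [hs.1]) _)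

theorem integral_jacobi_pos {α β : ℝ} (hα : -1 < α) (hβ : 0 ≤ β) :
    0 < ∫ u in (-1 : ℝ)..1, (1 - u) ^ α * (1 + u) ^ β :=
  intervalIntegral.intervalIntegral_pos_of_pos_on (intervalIntegrable_jacobi hα hβ)
    (fun _ hs => jacobi_pos hs) (by norm_num)

theorem intervalIntegrable_jacobiWeight {α β : ℝ} (hα : -1 < α) (hβ : 0 ≤ β) :
    IntervalIntegrable (jacobiWeight α β) volume (-1) 1 :=
  (intervalIntegrable_jacobi hα hβ).div_const _

theorem jacobiWeight_pos {α β : ℝ} (hα : -1 < α) (hβ : 0 ≤ β) :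
    ∀ s ∈ Ioo (-1 : ℝ) 1, 0 < jacobiWeight α β s := fun _ hs =>
  div_pos (jacobi_pos hs) (integral_jacobi_pos hα hβ)

theorem jacobiOrthonormal_eval_one_ne_zero {α β : ℝ} (hα : -1 < α) (hβ : 0 ≤ β) (l : ℕ) :
    (jacobiOrthonormal α β l).eval 1 ≠ 0 :=
  orthonormalPoly_eval_right_ne_zero (by norm_num) (intervalIntegrable_jacobiWeight hα hβ)
    (jacobiWeight_pos hα hβ) l

theorem jacobiOrthonormal_natDegree {α β : ℝ} (hα : -1 < α) (hβ : 0 ≤ β) (l : ℕ) :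
    (jacobiOrthonormal α β l).natDegree = l :=
  orthonormalPoly_natDegree (by norm_num) (intervalIntegrable_jacobiWeight hα hβ)
    (jacobiWeight_pos hα hβ) l

theorem jacobiOrthonormal_ne_zero {α β : ℝ} (hα : -1 < α) (hβ : 0 ≤ β) (l : ℕ) :
    jacobiOrthonormal α β l ≠ 0 :=
  orthonormalPoly_ne_zero (by norm_num) (intervalIntegrable_jacobiWeight hα hβ)
    (jacobiWeight_pos hα hβ) l

theorem hConst_pos {μ : ℝ} (hμ : 0 ≤ μ) (l k : ℕ) : 0 < hConst μ l k := by
  rw [hConst]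
  refine Real.sqrt_pos.2 (div_pos (Real.Gamma_pos_of_pos (by positivity)) (mul_pos
    (Real.Gamma_pos_of_pos (by positivity)) (Real.Gamma_pos_of_pos (by positivity))))

theorem HConst_ne_zero {μ : ℝ} (hμ : 0 ≤ μ) (l k : ℕ) : HConst μ l k ≠ 0 :=
  mul_ne_zero (hConst_pos hμ l k).ne'
    (jacobiOrthonormal_eval_one_ne_zero (by linarith) (by positivity) l)

/-- On the unit circle the Jacobi argument is `1`, so the radial part reduces to `H`. This is the
origin of the factor `H⁻²` in `DKernel`. -/
theorem discBasis_cos_sin (μ : ℝ) (ε : Fin 2) (l k : ℕ) (ξ : ℝ) :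
    discBasis μ ε l k (Real.cos ξ) (Real.sin ξ) = (if 2 * l < k then √2 else 1) * HConst μ l k *
      angular ε (k - 2 * l) (Real.cos ξ) (Real.sin ξ) := by
  rw [discBasis, HConst, Real.cos_sq_add_sin_sq]
  norm_num [mul_assoc]

/-- The kernel `D_k` reproduces the orthogonal polynomials of degree `k` from their values at
equally spaced points of the half circle. -/
theorem sum_discBasis_mul_DKernel {μ : ℝ} (hμ : 0 ≤ μ) {n k l : ℕ} (hk : k ≤ n) (hl : 2 * l ≤ k)
    (ε : Fin 2) (x y : ℝ) :
    ∑ ν : Fin (n + 1), discBasis μ ε l k (Real.cos (angle n ν)) (Real.sin (angle n ν)) *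
      DKernel μ k (angle n ν) x y = (n + 1) * discBasis μ ε l k x y := by
  have hsum : ∀ l' ∈ Finset.range (k / 2 + 1), ∀ ε' : Fin 2,
      ∑ ν : Fin (n + 1), discBasis μ ε l k (Real.cos (angle n ν)) (Real.sin (angle n ν)) *
        ((1 / HConst μ l' k ^ 2) *
          discBasis μ ε' l' k (Real.cos (angle n ν)) (Real.sin (angle n ν)) *
            discBasis μ ε' l' k x y) =
      if l = l' ∧ ε = ε' then (n + 1) * discBasis μ ε l k x y else 0 := by
    intro l' hl' ε'
    have hl2 : 2 * l' ≤ k := by rw [Finset.mem_range] at hl'; omega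
    -- The frequencies occurring in a fixed degree `k` all have the parity of `k`.
    have h := sum_angular_mul_angular (n := n) (m := k - 2 * l) (m' := k - 2 * l') (by omega)
      (by omega) (by omega) ε ε'
    have hfac : ∀ ν : Fin (n + 1),
        discBasis μ ε l k (Real.cos (angle n ν)) (Real.sin (angle n ν)) *
        ((1 / HConst μ l' k ^ 2) *
          discBasis μ ε' l' k (Real.cos (angle n ν)) (Real.sin (angle n ν)) *
            discBasis μ ε' l' k x y) =
        ((if 2 * l < k then √2 else 1) * HConst μ l k * (1 / HConst μ l' k ^ 2) *
          (if 2 * l' < k then √2 else 1) * HConst μ l' k * discBasis μ ε' l' k x y) *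
        (angular ε (k - 2 * l) (Real.cos (angle n ν)) (Real.sin (angle n ν)) *
          angular ε' (k - 2 * l') (Real.cos (angle n ν)) (Real.sin (angle n ν))) := fun ν => by
      rw [discBasis_cos_sin, discBasis_cos_sin]; ring
    simp_rw [hfac]
    rw [← Finset.mul_sum, h]
    have hH := HConst_ne_zero hμ l k
    by_cases hll : l = l' ∧ ε = ε'
    · obtain ⟨rfl, rfl⟩ := hll
      by_cases hlk : 2 * l < k
      · have h0 : k - 2 * l ≠ 0 := by omega
        -- The two normalizations `√2` compensate for the discrete norm `(n + 1) / 2` of a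
        -- nonconstant cosine or sine.
        have h2 : √2 * √2 = (2 : ℝ) := Real.mul_self_sqrt (by norm_num)
        simp only [hlk, h0, and_self, if_true, if_false]
        field_simp
        linear_combination discBasis μ ε l k x y * h2
      · have h0 : k - 2 * l = 0 := by omega
        by_cases hε : ε = 0
        · simp only [hlk, h0, hε, and_self, if_true, if_false]
          field_simp
        · have h3 : discBasis μ ε l k x y = 0 := by simp [discBasis, angular, hε, h0]
          simp [h3]
    · have hll' : ¬(k - 2 * l = k - 2 * l' ∧ ε = ε') := fun hc => hll ⟨by omega, hc.2⟩
      simp only [hll, hll', if_false, mul_zero]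
  simp only [DKernel, Finset.mul_sum]
  rw [Finset.sum_comm, Finset.sum_eq_single_of_mem l (Finset.mem_range.2 (by omega))]
  · rw [Finset.sum_comm, Finset.sum_eq_single ε]
    · rw [hsum l (Finset.mem_range.2 (by omega)) ε, if_pos ⟨rfl, rfl⟩]
    · intro ε' _ hε'
      rw [hsum l (Finset.mem_range.2 (by omega)) ε', if_neg (fun h => hε' h.2.symm)]
    · simp
  · intro l' hl' hne
    rw [Finset.sum_comm]
    refine Finset.sum_eq_zero fun ε' _ => ?_
    rw [hsum l' hl' ε', if_neg (fun h => hne h.1.symm)]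

/-! ### Integration over the unit disk -/

/-- For `μ < 1/2` the weight is unbounded at the end points; it is the integrable Chebyshev weight
times the continuous function `(1 - s²)^μ`. -/
theorem intervalIntegrable_one_sub_sq_rpow_sub_half {μ : ℝ} (hμ : 0 ≤ μ) :
    IntervalIntegrable (fun s : ℝ => (1 - s ^ 2) ^ (μ - 1 / 2)) volume (-1) 1 := by
  have h := Polynomial.Chebyshev.intervalIntegrable_sqrt_one_sub_sq_inv.continuousOn_mul
    (g := fun s : ℝ => (1 - s ^ 2) ^ μ)
    (Continuous.rpow_const (by fun_prop) fun _ => Or.inr hμ).continuousOn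
  rw [intervalIntegrable_iff_integrableOn_Ioo_of_le (by norm_num)] at h ⊢
  refine h.congr_fun (fun s hs => ?_) measurableSet_Ioo
  have h0 : 0 < 1 - s ^ 2 := by nlinarith [hs.1, hs.2]
  simp only
  rw [Real.rpow_sub h0, ← Real.sqrt_eq_rpow, Real.sqrt_inv, div_eq_mul_inv]

theorem one_sub_mul_sq_sub_sq_rpow {t u s : ℝ} (hu : u ^ 2 = 1 - t ^ 2) (hs : s ∈ Icc (-1 : ℝ) 1)
    (α : ℝ) : (1 - (u * s) ^ 2 - t ^ 2) ^ α = (1 - t ^ 2) ^ α * (1 - s ^ 2) ^ α := by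
  have h0 : 0 ≤ 1 - s ^ 2 := by nlinarith [hs.1, hs.2]
  rw [← Real.mul_rpow (hu ▸ sq_nonneg u) h0]
  congr 1
  linear_combination (-s ^ 2) * hu

theorem one_sub_sq_pos {t : ℝ} (ht : t ∈ Ioo (-1 : ℝ) 1) : 0 < 1 - t ^ 2 := by
  nlinarith [ht.1, ht.2]

/-- A chord integral, rescaled to `[-1, 1]`. -/
theorem integral_chord (μ : ℝ) {t : ℝ} (ht : t ∈ Ioo (-1 : ℝ) 1) (H : ℝ → ℝ) :
    ∫ s in (-√(1 - t ^ 2))..√(1 - t ^ 2), H s * (1 - s ^ 2 - t ^ 2) ^ (μ - 1 / 2) =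
      (1 - t ^ 2) ^ μ * ∫ s in (-1 : ℝ)..1, H (√(1 - t ^ 2) * s) * (1 - s ^ 2) ^ (μ - 1 / 2) := by
  have h0 := one_sub_sq_pos ht
  have hu := Real.sqrt_pos.2 h0
  have hu2 := Real.sq_sqrt h0.le
  have h := intervalIntegral.mul_integral_comp_mul_left (a := -1) (b := 1)
    (f := fun s => H s * (1 - s ^ 2 - t ^ 2) ^ (μ - 1 / 2)) (√(1 - t ^ 2))
  rw [mul_one, mul_neg_one] at h
  rw [← h]
  have hcongr : ∀ s ∈ uIcc (-1 : ℝ) 1,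
      H (√(1 - t ^ 2) * s) * (1 - (√(1 - t ^ 2) * s) ^ 2 - t ^ 2) ^ (μ - 1 / 2) =
      (1 - t ^ 2) ^ (μ - 1 / 2) * (H (√(1 - t ^ 2) * s) * (1 - s ^ 2) ^ (μ - 1 / 2)) := by
    intro s hs
    rw [uIcc_of_le (by norm_num)] at hs
    rw [one_sub_mul_sq_sub_sq_rpow hu2 hs]
    ring
  rw [intervalIntegral.integral_congr hcongr, intervalIntegral.integral_const_mul, ← mul_assoc]
  congr 1
  nth_rewrite 1 [Real.sqrt_eq_rpow]
  rw [← Real.rpow_add h0]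
  congr 1
  ring

/-- The weight `(1 - x² - y²)^{μ - 1/2}` on the open unit disk, extended by zero. -/
def discWeight (μ : ℝ) (p : ℝ × ℝ) : ℝ :=
  if p.1 ^ 2 + p.2 ^ 2 < 1 then (1 - p.2 ^ 2 - p.1 ^ 2) ^ (μ - 1 / 2) else 0

theorem discWeight_slice_mul (μ : ℝ) {t : ℝ} (ht : t ∈ Ioo (-1 : ℝ) 1) (H : ℝ → ℝ) :
    (fun y => discWeight μ (t, y) * H y) = (Ioo (-√(1 - t ^ 2)) √(1 - t ^ 2)).indicator
      fun y => H y * (1 - y ^ 2 - t ^ 2) ^ (μ - 1 / 2) := by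
  funext y
  have h0 := one_sub_sq_pos ht
  have hiff : t ^ 2 + y ^ 2 < 1 ↔ y ∈ Ioo (-√(1 - t ^ 2)) √(1 - t ^ 2) := by
    rw [mem_Ioo, ← abs_lt, ← Real.sqrt_sq_eq_abs, Real.sqrt_lt_sqrt_iff (sq_nonneg y)]
    constructor <;> intro h <;> linarith
  by_cases hy : t ^ 2 + y ^ 2 < 1
  · rw [indicator_of_mem (hiff.1 hy), discWeight, if_pos hy, mul_comm]
  · rw [indicator_of_notMem (fun h => hy (hiff.2 h)), discWeight, if_neg hy, zero_mul]

theorem discWeight_slice_of_notMem (μ : ℝ) {t : ℝ} (ht : t ∉ Ioo (-1 : ℝ) 1) (y : ℝ) :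
    discWeight μ (t, y) = 0 := by
  rw [discWeight, if_neg]
  simp only [not_lt]
  have : ¬ t ^ 2 < 1 := fun h => ht (abs_lt.1 ((sq_lt_one_iff_abs_lt_one t).1 h))
  nlinarith [sq_nonneg y]

theorem integral_discWeight_slice_mul (μ : ℝ) {t : ℝ} (ht : t ∈ Ioo (-1 : ℝ) 1) (H : ℝ → ℝ) :
    ∫ y, discWeight μ (t, y) * H y = (1 - t ^ 2) ^ μ *
      ∫ s in (-1 : ℝ)..1, H (√(1 - t ^ 2) * s) * (1 - s ^ 2) ^ (μ - 1 / 2) := by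
  have hle : -√(1 - t ^ 2) ≤ √(1 - t ^ 2) := neg_le_self (Real.sqrt_nonneg _)
  rw [discWeight_slice_mul μ ht, integral_indicator measurableSet_Ioo, ← integral_chord μ ht,
    intervalIntegral.integral_of_le hle, integral_Ioc_eq_integral_Ioo]

theorem measurable_discWeight (μ : ℝ) : Measurable (discWeight μ) := by
  refine Measurable.ite (measurableSet_lt (by fun_prop) (by fun_prop)) ?_ measurable_const
  exact Measurable.pow_const (by fun_prop) _

theorem discWeight_nonneg (μ : ℝ) (p : ℝ × ℝ) : 0 ≤ discWeight μ p := by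
  rw [discWeight]
  split_ifs with h
  · exact Real.rpow_nonneg (by linarith) _
  · exact le_rfl

theorem integrable_discWeight_slice {μ : ℝ} (hμ : 0 ≤ μ) (t : ℝ) :
    Integrable (fun y => discWeight μ (t, y)) := by
  by_cases ht : t ∈ Ioo (-1 : ℝ) 1
  · have h := discWeight_slice_mul μ ht fun _ => 1
    simp only [mul_one, one_mul] at h
    have h0 := one_sub_sq_pos ht
    have hu := Real.sqrt_pos.2 h0
    have hu2 := Real.sq_sqrt h0.le
    rw [h, integrable_indicator_iff measurableSet_Ioo]
    have h1 := ((intervalIntegrable_one_sub_sq_rpow_sub_half hμ).comp_mul_left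
      (c := (√(1 - t ^ 2))⁻¹)).const_mul ((1 - t ^ 2) ^ (μ - 1 / 2))
    rw [div_inv_eq_mul, div_inv_eq_mul, one_mul, neg_one_mul,
      intervalIntegrable_iff_integrableOn_Ioo_of_le (by linarith)] at h1
    refine h1.congr_fun (fun y hy => ?_) measurableSet_Ioo
    have hy' : (√(1 - t ^ 2))⁻¹ * y ∈ Icc (-1 : ℝ) 1 := by
      rw [inv_mul_eq_div]
      exact ⟨by rw [le_div_iff₀ hu]; linarith [hy.1], by rw [div_le_iff₀ hu]; linarith [hy.2]⟩
    simp only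
    rw [← one_sub_mul_sq_sub_sq_rpow hu2 hy', mul_inv_cancel_left₀ hu.ne']
  · simp only [discWeight_slice_of_notMem μ ht]
    exact integrable_zero _ _ _

/-- By Tonelli: the slice integrals are `(1 - t²)^μ` times a constant on `(-1, 1)` and zero
elsewhere. -/
theorem integrable_discWeight {μ : ℝ} (hμ : 0 ≤ μ) :
    Integrable (discWeight μ) (volume.prod volume) := by
  rw [integrable_prod_iff (measurable_discWeight μ).aestronglyMeasurable]
  refine ⟨Filter.Eventually.of_forall (integrable_discWeight_slice hμ), ?_⟩
  have h : (fun t => ∫ y, ‖discWeight μ (t, y)‖) = (Ioo (-1 : ℝ) 1).indicator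
      fun t => (1 - t ^ 2) ^ μ * ∫ s in (-1 : ℝ)..1, (1 - s ^ 2) ^ (μ - 1 / 2) := by
    funext t
    simp only [Real.norm_of_nonneg (discWeight_nonneg μ _)]
    by_cases ht : t ∈ Ioo (-1 : ℝ) 1
    · have := integral_discWeight_slice_mul μ ht fun _ => 1
      simp only [mul_one, one_mul] at this
      rw [indicator_of_mem ht, this]
    · simp only [discWeight_slice_of_notMem μ ht, integral_zero, indicator_of_notMem ht]
  rw [h, integrable_indicator_iff measurableSet_Ioo]
  have := (intervalIntegrable_one_sub_sq_rpow hμ).mul_const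
    (∫ s in (-1 : ℝ)..1, (1 - s ^ 2) ^ (μ - 1 / 2))
  rwa [intervalIntegrable_iff_integrableOn_Ioo_of_le (by norm_num)] at this

/-- A continuous `F` is bounded on the square `[-1, 1]²`, which contains the support of the weight.
-/
theorem integrable_discWeight_mul {μ : ℝ} (hμ : 0 ≤ μ) {F : ℝ × ℝ → ℝ} (hF : Continuous F) :
    Integrable (fun p => discWeight μ p * F p) (volume.prod volume) := by
  obtain ⟨M, hM⟩ := ((isCompact_Icc (a := (-1 : ℝ)) (b := 1)).prod
    (isCompact_Icc (a := (-1 : ℝ)) (b := 1))).exists_bound_of_continuousOn hF.continuousOn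
  refine ((integrable_discWeight hμ).mul_const M).mono'
    ((measurable_discWeight μ).mul hF.measurable).aestronglyMeasurable
    (Filter.Eventually.of_forall fun p => ?_)
  rw [norm_mul, Real.norm_of_nonneg (discWeight_nonneg μ p)]
  by_cases hp : p.1 ^ 2 + p.2 ^ 2 < 1
  · refine mul_le_mul_of_nonneg_left (hM p ?_) (discWeight_nonneg μ p)
    refine ⟨abs_le.1 ((sq_le_one_iff_abs_le_one _).1 ?_),
      abs_le.1 ((sq_le_one_iff_abs_le_one _).1 ?_)⟩
    · nlinarith [sq_nonneg p.2]
    · nlinarith [sq_nonneg p.1]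
  · simp [discWeight, hp]

/-- Integration over the unit disk along parallel chords. -/
theorem integral_discWeight_mul_chords {μ : ℝ} (hμ : 0 ≤ μ) {F : ℝ × ℝ → ℝ} (hF : Continuous F) :
    ∫ p, discWeight μ p * F p = ∫ t in (-1 : ℝ)..1,
      (∫ s in (-1 : ℝ)..1, F (t, √(1 - t ^ 2) * s) * (1 - s ^ 2) ^ (μ - 1 / 2)) *
        (1 - t ^ 2) ^ μ := by
  rw [Measure.volume_eq_prod, integral_prod _ (integrable_discWeight_mul hμ hF),
    intervalIntegral.integral_of_le (by norm_num), integral_Ioc_eq_integral_Ioo,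
    ← integral_indicator measurableSet_Ioo]
  congr 1
  funext t
  by_cases ht : t ∈ Ioo (-1 : ℝ) 1
  · rw [indicator_of_mem ht, integral_discWeight_slice_mul μ ht fun y => F (t, y), mul_comm]
  · simp only [discWeight_slice_of_notMem μ ht, zero_mul, integral_zero, indicator_of_notMem ht]

/-- Integration over the unit disk in polar coordinates, for a product function. -/
theorem integral_discWeight_mul_polar (μ : ℝ) {F : ℝ × ℝ → ℝ} {f h : ℝ → ℝ}
    (hFfh : ∀ r φ, F (r * Real.cos φ, r * Real.sin φ) = f r * h φ) :
    ∫ p, discWeight μ p * F p =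
      (∫ r in Ioo (0 : ℝ) 1, r * (1 - r ^ 2) ^ (μ - 1 / 2) * f r) *
        ∫ φ in Ioo (-Real.pi) Real.pi, h φ := by
  rw [← integral_comp_polarCoord_symm, polarCoord_target]
  have hpt : ∀ p ∈ Ioi (0 : ℝ) ×ˢ Ioo (-Real.pi) Real.pi,
      p.1 • (discWeight μ (polarCoord.symm p) * F (polarCoord.symm p)) =
        (Iio (1 : ℝ)).indicator (fun r => r * (1 - r ^ 2) ^ (μ - 1 / 2) * f r) p.1 * h p.2 := by
    rintro ⟨r, φ⟩ ⟨hr, -⟩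
    simp only [mem_Ioi] at hr
    have hsq : (r * Real.cos φ) ^ 2 + (r * Real.sin φ) ^ 2 = r ^ 2 := by
      linear_combination r ^ 2 * Real.sin_sq_add_cos_sq φ
    simp only [polarCoord_symm_apply, hFfh, smul_eq_mul]
    by_cases hr1 : r < 1
    · have h1 : (r * Real.cos φ) ^ 2 + (r * Real.sin φ) ^ 2 < 1 := by rw [hsq]; nlinarith
      have h2 : 1 - (r * Real.sin φ) ^ 2 - (r * Real.cos φ) ^ 2 = 1 - r ^ 2 := by linarith
      rw [indicator_of_mem (by exact hr1), discWeight, if_pos h1]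
      simp only [h2]
      ring
    · have h1 : ¬ (r * Real.cos φ) ^ 2 + (r * Real.sin φ) ^ 2 < 1 := by rw [hsq]; nlinarith
      rw [indicator_of_notMem (by exact hr1), discWeight, if_neg h1]
      ring
  rw [setIntegral_congr_fun (measurableSet_Ioi.prod measurableSet_Ioo) hpt,
    Measure.volume_eq_prod, setIntegral_prod_mul, setIntegral_indicator measurableSet_Iio]
  rfl

theorem integral_mul_one_sub_sq_rpow {μ : ℝ} (hμ : 0 ≤ μ) :
    ∫ r in Ioo (0 : ℝ) 1, r * (1 - r ^ 2) ^ (μ - 1 / 2) = 1 / (2 * (μ + 1 / 2)) := by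
  rw [← integral_Ioc_eq_integral_Ioo, ← intervalIntegral.integral_of_le zero_le_one]
  have hlam : 0 < μ + 1 / 2 := by positivity
  have hint : IntervalIntegrable (fun r : ℝ => r * (1 - r ^ 2) ^ (μ - 1 / 2)) volume 0 1 := by
    refine ((intervalIntegrable_one_sub_sq_rpow_sub_half hμ).mono_set ?_).continuousOn_mul
      continuousOn_id
    rw [uIcc_of_le zero_le_one, uIcc_of_le (by norm_num)]
    exact Icc_subset_Icc (by norm_num) le_rfl
  -- The integrand may blow up at `r = 1`, so the derivative is taken in the open interval and the
  -- antiderivative is only continuous at the ends.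
  have hd : ∀ x ∈ Ioo (0 : ℝ) 1, HasDerivAt
      (fun r : ℝ => -(1 / (2 * (μ + 1 / 2))) * (1 - r ^ 2) ^ (μ + 1 / 2))
      (x * (1 - x ^ 2) ^ (μ - 1 / 2)) x := by
    intro x hx
    have h0 : 0 < 1 - x ^ 2 := by nlinarith [hx.1, hx.2]
    have h1 : HasDerivAt (fun s : ℝ => 1 - s ^ 2) (-(2 * x)) x := by
      simpa using (hasDerivAt_pow 2 x).const_sub 1
    refine ((h1.rpow_const (p := μ + 1 / 2) (Or.inl h0.ne')).const_mul _).congr_deriv ?_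
    have : μ + 1 / 2 - 1 = μ - 1 / 2 := by ring
    rw [this]
    field_simp
  have hc : ContinuousOn (fun r : ℝ => -(1 / (2 * (μ + 1 / 2))) * (1 - r ^ 2) ^ (μ + 1 / 2))
      (Icc 0 1) :=
    (continuous_const.mul
      (Continuous.rpow_const (by fun_prop) fun _ => Or.inr hlam.le)).continuousOn
  rw [intervalIntegral.integral_eq_sub_of_hasDerivAt_of_le zero_le_one hc hd hint]
  rw [one_pow, sub_self, Real.zero_rpow hlam.ne']
  simp

/-- The normalization `a_μ ∫ W_μ = 1` of the weight on the disk, in terms of chords. -/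
theorem integral_chord_mul_gegenbauerIntegral_one {μ : ℝ} (hμ : 0 ≤ μ) :
    (∫ s in (-1 : ℝ)..1, (1 - s ^ 2) ^ (μ - 1 / 2)) * gegenbauerIntegral μ hμ 1 =
      Real.pi / (μ + 1 / 2) := by
  -- The mass of the disk weight, computed by chords and in polar coordinates.
  have h1 := integral_discWeight_mul_chords hμ (F := fun _ => 1) continuous_const
  have h2 := integral_discWeight_mul_polar μ (F := fun _ => 1) (f := fun _ => 1) (h := fun _ => 1)
    (fun _ _ => by simp)
  rw [h1] at h2
  simp only [one_mul, mul_one, intervalIntegral.integral_const_mul] at h2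
  rw [integral_mul_one_sub_sq_rpow hμ] at h2
  rw [gegenbauerIntegral_apply]
  simp only [eval_one, one_mul]
  rw [h2]
  have := Real.pi_pos
  simp only [integral_const, MeasurableSet.univ, measureReal_restrict_apply, univ_inter,
    smul_eq_mul, mul_one, Real.volume_real_Ioo_of_le (by linarith : -Real.pi ≤ Real.pi)]
  field_simp
  ring

/-! ### Trigonometric and radial orthogonality -/

/-- The power `cos^i` contains only the frequencies `i, i - 2, …, -i`, and the hypothesis says that
`m` is not among them. The induction trades one factor `cos φ` for the shifts `m ± 1`, so `m` has to
range over the integers. -/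
theorem integral_cos_mul_cos_pow (i : ℕ) (m : ℤ) (h : (i : ℤ) < |m| ∨ ¬ (2 : ℤ) ∣ i + m) :
    ∫ φ in (-Real.pi)..Real.pi, Real.cos (m * φ) * Real.cos φ ^ i = 0 := by
  induction i generalizing m with
  | zero =>
    have hm : m ≠ 0 := by rintro rfl; simp at h
    have hm' : (m : ℝ) ≠ 0 := by exact_mod_cast hm
    simp only [pow_zero, mul_one]
    rw [intervalIntegral.integral_comp_mul_left (fun x => Real.cos x) hm', integral_cos]
    simp
  | succ i ih =>
    have e : ∀ φ : ℝ, Real.cos (m * φ) * Real.cos φ ^ (i + 1) =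
        1 / 2 * (Real.cos ((m + 1 : ℤ) * φ) * Real.cos φ ^ i) +
        1 / 2 * (Real.cos ((m - 1 : ℤ) * φ) * Real.cos φ ^ i) := fun φ => by
      push_cast
      rw [add_mul, sub_mul, one_mul, Real.cos_add, Real.cos_sub]
      ring
    simp only [e]
    rw [intervalIntegral.integral_add (Continuous.intervalIntegrable (by fun_prop) _ _)
      (Continuous.intervalIntegrable (by fun_prop) _ _), intervalIntegral.integral_const_mul,
      intervalIntegral.integral_const_mul, ih (m + 1), ih (m - 1)]
    · simp
    · rcases h with h | h
      · left; push_cast at h; grind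
      · right; push_cast at h; omega
    · rcases h with h | h
      · left; push_cast at h; grind
      · right; push_cast at h; omega

theorem image_two_mul_sq_sub_one :
    (fun r : ℝ => 2 * r ^ 2 - 1) '' Ioo 0 1 = Ioo (-1) 1 := by
  ext v
  constructor
  · rintro ⟨r, hr, rfl⟩
    exact ⟨by nlinarith [hr.1, hr.2], by nlinarith [hr.1, hr.2]⟩
  · intro hv
    have h0 : 0 < (v + 1) / 2 := by linarith [hv.1]
    refine ⟨√((v + 1) / 2), ⟨Real.sqrt_pos.2 h0, ?_⟩, ?_⟩
    · rw [Real.sqrt_lt' one_pos]; linarith [hv.2]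
    · simp only [Real.sq_sqrt h0.le]; ring

/-- Orthogonality of the Jacobi polynomials in the radial variable. -/
theorem integral_jacobiOrthonormal_radial {α : ℝ} (hα : -1 < α) (m l b : ℕ) (hb : b < l) :
    ∫ r in Ioo (0 : ℝ) 1, r * (1 - r ^ 2) ^ α *
      ((jacobiOrthonormal α m l).eval (2 * r ^ 2 - 1) * r ^ (2 * m + 2 * b)) = 0 := by
  have hm : (0 : ℝ) ≤ m := Nat.cast_nonneg m
  -- With `v = 2 r² - 1` one has `1 - v = 2 (1 - r²)` and `1 + v = 2 r²`. The factor `r^(2m)`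
  -- belongs to the Jacobi weight, `r dr` to the substitution, and `r^(2b)` is the test polynomial
  -- `(1 + v)^b` up to a constant.
  have hdeg : ((1 + X : ℝ[X]) ^ b).degree < l := by
    have h1 : ((1 + X : ℝ[X]) ^ b).natDegree ≤ b := by
      refine natDegree_pow_le.trans ?_
      have : (1 + X : ℝ[X]).natDegree ≤ 1 := (natDegree_add_le _ _).trans (by simp)
      nlinarith
    refine degree_le_natDegree.trans_lt ?_
    exact_mod_cast h1.trans_lt hb
  have h := weightedIntegral_orthonormalPoly_mul (by norm_num)
    (intervalIntegrable_jacobiWeight hα hm) (jacobiWeight_pos hα hm) hdeg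
  rw [weightedIntegral_apply, intervalIntegral.integral_of_le (by norm_num),
    integral_Ioc_eq_integral_Ioo, ← image_two_mul_sq_sub_one,
    integral_image_eq_integral_abs_deriv_smul measurableSet_Ioo (f' := fun r => 4 * r)] at h
  · have hI := integral_jacobi_pos hα hm
    set I := ∫ u in (-1 : ℝ)..1, (1 - u) ^ α * (1 + u) ^ (m : ℝ) with hIdef
    have hpt : ∀ r ∈ Ioo (0 : ℝ) 1, |4 * r| •
        ((orthonormalPoly (jacobiWeight α m) (-1) 1 l * (1 + X) ^ b).eval (2 * r ^ 2 - 1) *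
          jacobiWeight α m (2 * r ^ 2 - 1)) =
        (4 * 2 ^ b * 2 ^ α * 2 ^ m / I) * (r * (1 - r ^ 2) ^ α *
          ((jacobiOrthonormal α m l).eval (2 * r ^ 2 - 1) * r ^ (2 * m + 2 * b))) := by
      intro r hr
      have h0 : 0 ≤ 1 - r ^ 2 := by nlinarith [hr.1, hr.2]
      have e1 : 1 - (2 * r ^ 2 - 1) = 2 * (1 - r ^ 2) := by ring
      have e2 : 1 + (2 * r ^ 2 - 1) = 2 * r ^ 2 := by ring
      rw [abs_of_pos (by linarith [hr.1]), jacobiWeight, ← hIdef, e1, e2,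
        Real.mul_rpow (by norm_num) h0, Real.rpow_natCast, jacobiOrthonormal]
      simp only [eval_mul, eval_pow, eval_add, eval_one, eval_X, e2, smul_eq_mul]
      rw [mul_pow, mul_pow, pow_add, pow_mul, pow_mul]
      field_simp
    rw [setIntegral_congr_fun measurableSet_Ioo hpt, integral_const_mul] at h
    refine (mul_eq_zero.1 h).resolve_left ?_
    have := Real.rpow_pos_of_pos (two_pos (α := ℝ)) α
    positivity
  · intro x _
    refine HasDerivAt.hasDerivWithinAt ?_
    have := ((hasDerivAt_pow 2 x).const_mul 2).sub_const 1
    refine this.congr_deriv ?_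
    push_cast
    ring
  · intro x hx y hy hxy
    simp only at hxy
    have : (x - y) * (x + y) = 0 := by linear_combination hxy / 2
    rcases mul_eq_zero.1 this with h | h
    · linarith
    · linarith [hx.1, hy.1]

/-! ### Chord averages of polynomials

A bivariate polynomial `G : ℝ[X][Y]` is evaluated at `Y = t`, the distance of the chord from the
origin, and at `X = s`, the rescaled position on the chord. -/

/-- The functional `p ↦ ∫ p(s) (1 - s²)^{μ - 1/2} ds` over `[-1, 1]`. -/
def chordIntegral (μ : ℝ) (hμ : 0 ≤ μ) : ℝ[X] →ₗ[ℝ] ℝ :=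
  weightedIntegral (fun s : ℝ => (1 - s ^ 2) ^ (μ - 1 / 2)) (-1) 1
    (intervalIntegrable_one_sub_sq_rpow_sub_half hμ)

/-- The average over `s` of a bivariate polynomial, as a polynomial in `t`. -/
def chordAverage (μ : ℝ) (hμ : 0 ≤ μ) (G : ℝ[X][Y]) : ℝ[X] :=
  ∑ i ∈ Finset.range (G.natDegree + 1), C (chordIntegral μ hμ (G.coeff i)) * X ^ i

theorem chordAverage_natDegree_le {μ : ℝ} (hμ : 0 ≤ μ) (G : ℝ[X][Y]) :
    (chordAverage μ hμ G).natDegree ≤ G.natDegree :=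
  natDegree_sum_le_of_forall_le _ _ fun _ hi =>
    (natDegree_C_mul_X_pow_le _ _).trans (Nat.le_of_lt_succ (Finset.mem_range.1 hi))

theorem chordAverage_eval {μ : ℝ} (hμ : 0 ≤ μ) (G : ℝ[X][Y]) (t : ℝ) :
    (chordAverage μ hμ G).eval t =
      ∫ s in (-1 : ℝ)..1, G.evalEval s t * (1 - s ^ 2) ^ (μ - 1 / 2) := by
  have h : G.eval (C t) = ∑ i ∈ Finset.range (G.natDegree + 1), (t ^ i) • G.coeff i := by
    rw [eval_eq_sum_range]
    refine Finset.sum_congr rfl fun i _ => ?_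
    rw [smul_eq_C_mul, C_pow, mul_comm]
  have h2 : ∫ s in (-1 : ℝ)..1, G.evalEval s t * (1 - s ^ 2) ^ (μ - 1 / 2) =
      chordIntegral μ hμ (G.eval (C t)) := rfl
  rw [h2, h, map_sum, chordAverage, eval_finsetSum]
  refine Finset.sum_congr rfl fun i _ => ?_
  rw [map_smul, smul_eq_mul, eval_mul, eval_C, eval_pow, eval_X, mul_comm]

/-- The square of the distance from the origin: `t² + (1 - t²) s²`. -/
def radiusSq : ℝ[X][Y] := X ^ 2 + (1 - X ^ 2) * C (X ^ 2)

/-- The real part of `(t + i √(1 - t²) s)^m`. -/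
def chordCos : ℕ → ℝ[X][Y]
  | 0 => 1
  | 1 => X
  | (m + 2) => 2 * X * chordCos (m + 1) - radiusSq * chordCos m

theorem radiusSq_evalEval (s t : ℝ) :
    radiusSq.evalEval s t = t ^ 2 + (1 - t ^ 2) * s ^ 2 := by
  simp [radiusSq, evalEval]

theorem radiusSq_natDegree_le : radiusSq.natDegree ≤ 2 := by
  rw [radiusSq]
  refine (natDegree_add_le _ _).trans (max_le (natDegree_X_pow_le 2) ?_)
  refine (natDegree_mul_C_le _ _).trans ((natDegree_sub_le _ _).trans (max_le (by simp) ?_))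
  exact natDegree_X_pow_le 2

theorem chordCos_natDegree_le (m : ℕ) : (chordCos m).natDegree ≤ m := by
  induction m using Nat.twoStepInduction with
  | zero => simp [chordCos]
  | one => simp [chordCos]
  | more m ih1 ih2 =>
    rw [chordCos]
    refine (natDegree_sub_le _ _).trans (max_le ?_ ?_)
    · refine natDegree_mul_le.trans ?_
      have : (2 * X : ℝ[X][Y]).natDegree ≤ 1 := by
        refine natDegree_mul_le.trans ?_
        simp
      omega
    · refine natDegree_mul_le.trans ?_
      have := radiusSq_natDegree_le
      omega

/-- From `z^(m+2) = 2 Re(z) z^(m+1) - |z|² z^m`: the square root enters the real part only through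
its square, so no irrationality in `t` remains. Asking only for `u² = 1 - t²` avoids fixing a root.
-/
theorem chordCos_evalEval {s t u : ℝ} (hu : u ^ 2 = 1 - t ^ 2) (m : ℕ) :
    (chordCos m).evalEval s t = (((t : ℂ) + ((u * s : ℝ) : ℂ) * Complex.I) ^ m).re := by
  induction m using Nat.twoStepInduction with
  | zero => simp [chordCos]
  | one => simp [chordCos]
  | more m ih1 ih2 =>
    have hz : ((t : ℂ) + ((u * s : ℝ) : ℂ) * Complex.I) ^ (m + 2) =
        ((2 * t : ℝ) : ℂ) * ((t : ℂ) + ((u * s : ℝ) : ℂ) * Complex.I) ^ (m + 1) -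
        ((t ^ 2 + (1 - t ^ 2) * s ^ 2 : ℝ) : ℂ) *
          ((t : ℂ) + ((u * s : ℝ) : ℂ) * Complex.I) ^ m := by
      have : (1 - t ^ 2) * s ^ 2 = (u * s) ^ 2 := by rw [← hu]; ring
      rw [this]
      push_cast
      linear_combination (u * s) ^ 2 * ((t : ℂ) + ((u : ℂ) * s) * Complex.I) ^ m * Complex.I_sq
    rw [hz, Complex.sub_re, Complex.re_ofReal_mul, Complex.re_ofReal_mul, ← ih1, ← ih2, chordCos,
      evalEval_sub, evalEval_mul, evalEval_mul, evalEval_mul, radiusSq_evalEval]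
    simp [evalEval]

/-- The polynomial `p(2 r² - 1) r^m cos(m φ)` restricted to chords. -/
def chordPoly (p : ℝ[X]) (m : ℕ) : ℝ[X][Y] := aeval (2 * radiusSq - 1) p * chordCos m

theorem chordPoly_natDegree_le (p : ℝ[X]) (m : ℕ) :
    (chordPoly p m).natDegree ≤ m + 2 * p.natDegree := by
  have h1 : (2 * radiusSq - 1 : ℝ[X][Y]).natDegree ≤ 2 := by
    refine (natDegree_sub_le _ _).trans (max_le (natDegree_mul_le.trans ?_) (by simp))
    have := radiusSq_natDegree_le
    simpa using this
  have h2 : (aeval (2 * radiusSq - 1 : ℝ[X][Y]) p).natDegree ≤ 2 * p.natDegree := by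
    rw [aeval_eq_sum_range]
    refine natDegree_sum_le_of_forall_le _ _ fun i hi => ?_
    have hi' := Finset.mem_range.1 hi
    refine (natDegree_smul_le _ _).trans (natDegree_pow_le.trans ?_)
    nlinarith
  refine natDegree_mul_le.trans ?_
  have := chordCos_natDegree_le m
  omega

theorem chordPoly_evalEval {s t u : ℝ} (hu : u ^ 2 = 1 - t ^ 2) (p : ℝ[X]) (m : ℕ) :
    (chordPoly p m).evalEval s t = p.eval (2 * (t ^ 2 + (u * s) ^ 2) - 1) *
      (((t : ℂ) + ((u * s : ℝ) : ℂ) * Complex.I) ^ m).re := by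
  have h1 : ∀ G : ℝ[X][Y], (aeval G p).evalEval s t = p.eval (G.evalEval s t) := fun G => by
    rw [aeval_eq_sum_range, eval_eq_sum_range, evalEval_finsetSum]
    refine Finset.sum_congr rfl fun i _ => ?_
    simp [evalEval]
  have h2 : (2 * radiusSq - 1 : ℝ[X][Y]).evalEval s t = 2 * (t ^ 2 + (u * s) ^ 2) - 1 := by
    rw [evalEval_sub, evalEval_mul, radiusSq_evalEval, evalEval_one, mul_pow, hu]
    simp [evalEval]
  rw [chordPoly, evalEval_mul, h1, h2, chordCos_evalEval hu]

/-- The left side is the integral over the disk of `P(x, y) x^i`, summed along parallel chords. In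
polar coordinates it factors, and one of the two factors vanishes. -/
theorem gegenbauerIntegral_chordAverage_mul_X_pow {μ : ℝ} (hμ : 0 ≤ μ) (m l i : ℕ)
    (hi : i < m + 2 * l) : gegenbauerIntegral μ hμ
      (chordAverage μ hμ (chordPoly (jacobiOrthonormal (μ - 1 / 2) m l) m) * X ^ i) = 0 := by
  set p := jacobiOrthonormal (μ - 1 / 2) m l with hp
  let F : ℝ × ℝ → ℝ := fun q => p.eval (2 * (q.1 ^ 2 + q.2 ^ 2) - 1) *
    (((q.1 : ℂ) + (q.2 : ℂ) * Complex.I) ^ m).re * q.1 ^ i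
  have hF : Continuous F := by
    have := p.continuous
    fun_prop
  have h1 := integral_discWeight_mul_chords hμ hF
  have hpolar : ∀ r φ, F (r * Real.cos φ, r * Real.sin φ) =
      (p.eval (2 * r ^ 2 - 1) * r ^ (m + i)) * (Real.cos (m * φ) * Real.cos φ ^ i) := by
    intro r φ
    have hsq : (r * Real.cos φ) ^ 2 + (r * Real.sin φ) ^ 2 = r ^ 2 := by
      linear_combination r ^ 2 * Real.sin_sq_add_cos_sq φ
    have hz : ((r * Real.cos φ : ℝ) : ℂ) + ((r * Real.sin φ : ℝ) : ℂ) * Complex.I =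
        (r : ℂ) * ((Real.cos φ : ℂ) + Real.sin φ * Complex.I) := by push_cast; ring
    have ha := angular_cos_sin 0 m φ
    rw [angular, if_pos rfl, if_pos rfl] at ha
    simp only [F]
    rw [hsq, hz, mul_pow, ← Complex.ofReal_pow, Complex.re_ofReal_mul, ha]
    ring
  have h2 := integral_discWeight_mul_polar μ hpolar
  have h3 : (∫ t in (-1 : ℝ)..1,
      (∫ s in (-1 : ℝ)..1, F (t, √(1 - t ^ 2) * s) * (1 - s ^ 2) ^ (μ - 1 / 2)) *
        (1 - t ^ 2) ^ μ) = gegenbauerIntegral μ hμ (chordAverage μ hμ (chordPoly p m) * X ^ i) := by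
    rw [gegenbauerIntegral_apply]
    refine intervalIntegral.integral_congr fun t ht => ?_
    rw [uIcc_of_le (by norm_num)] at ht
    have h0 : 0 ≤ 1 - t ^ 2 := by nlinarith [ht.1, ht.2]
    simp only [eval_mul, eval_pow, eval_X]
    congr 1
    rw [chordAverage_eval, ← intervalIntegral.integral_mul_const]
    refine intervalIntegral.integral_congr fun s _ => ?_
    simp only [F]
    rw [chordPoly_evalEval (Real.sq_sqrt h0)]
    ring
  rw [← h3, ← h1, h2, ← integral_Ioc_eq_integral_Ioo (x := -Real.pi),
    ← intervalIntegral.integral_of_le (by linarith [Real.pi_pos])]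
  by_cases hmi : i < m ∨ ¬ (2 : ℤ) ∣ i + m
  · have := integral_cos_mul_cos_pow i m (by
      rcases hmi with h | h
      · left; rw [Nat.abs_cast]; exact_mod_cast h
      · right; exact h)
    rw [Int.cast_natCast] at this
    rw [this, mul_zero]
  -- Here the angular factor need not vanish, but `i < m + 2 l` gives `b < l`, and the radial factor
  -- is zero by Jacobi orthogonality.
  · obtain ⟨b, rfl⟩ : ∃ b, i = m + 2 * b := ⟨(i - m) / 2, by omega⟩
    have := integral_jacobiOrthonormal_radial (α := μ - 1 / 2) (by linarith) m l b (by omega)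
    have e : m + (m + 2 * b) = 2 * m + 2 * b := by omega
    rw [e, this, zero_mul]

/-- The chord average of an orthogonal polynomial on the disk is a multiple of the Gegenbauer
polynomial of the same degree. -/
theorem chordAverage_jacobiOrthonormal {μ : ℝ} (hμ : 0 ≤ μ) (m l : ℕ) :
    ∃ e : ℝ, chordAverage μ hμ (chordPoly (jacobiOrthonormal (μ - 1 / 2) m l) m) =
      e • gegenbauer (μ + 1 / 2) (m + 2 * l) := by
  set q := chordAverage μ hμ (chordPoly (jacobiOrthonormal (μ - 1 / 2) m l) m) with hq
  set k := m + 2 * l with hk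
  have hlam : 0 < μ + 1 / 2 := by positivity
  have hqdeg : q.natDegree ≤ k := by
    refine (chordAverage_natDegree_le hμ _).trans ((chordPoly_natDegree_le _ m).trans ?_)
    rw [jacobiOrthonormal_natDegree (by linarith) (by positivity)]
  have hcoeff := (gegenbauer_natDegree_le_and_coeff_pos hlam k).2
  set e := q.coeff k / (gegenbauer (μ + 1 / 2) k).coeff k with he
  refine ⟨e, ?_⟩
  -- Matching the top coefficients leaves `r` of degree below `k`. Both `q` and `C_k` are orthogonal
  -- to such polynomials, so `r` is orthogonal to itself and vanishes.
  set r := q - e • gegenbauer (μ + 1 / 2) k with hr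
  have hrdeg : r.degree < k := by
    rw [degree_lt_iff_coeff_zero]
    intro N hN
    rcases eq_or_lt_of_le hN with h | h
    · rw [← h, hr, coeff_sub, coeff_smul, smul_eq_mul, he, div_mul_cancel₀ _ hcoeff.ne', sub_self]
    · rw [hr, coeff_sub, coeff_smul, coeff_eq_zero_of_natDegree_lt (hqdeg.trans_lt h),
        coeff_eq_zero_of_natDegree_lt ((gegenbauer_natDegree hlam k).trans_lt h)]
      simp
  have h1 : gegenbauerIntegral μ hμ (q * r) = 0 :=
    map_mul_eq_zero_of_natDegree_lt (p := fun j => X ^ j) (fun j => pow_ne_zero _ X_ne_zero)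
      (fun j => natDegree_X_pow j) _
      (fun j hj => gegenbauerIntegral_chordAverage_mul_X_pow hμ m l j hj) hrdeg
  have h2 := gegenbauerIntegral_gegenbauer_mul_of_degree_lt hμ hrdeg
  have h3 : gegenbauerIntegral μ hμ (r * r) = 0 := by
    have : r * r = q * r - e • (gegenbauer (μ + 1 / 2) k * r) := by
      rw [← smul_mul_assoc, ← sub_mul]
    rw [this, map_sub, map_smul, h1, h2, smul_zero, sub_zero]
  by_contra hne
  have hr0 : r ≠ 0 := fun h => hne (sub_eq_zero.1 h)
  have h4 := weightedIntegral_pos (by norm_num) (intervalIntegrable_one_sub_sq_rpow hμ)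
    (fun x hx => Real.rpow_pos_of_pos (one_sub_sq_pos hx) μ) (p := r * r)
    (fun x _ => by simpa using mul_self_nonneg _) (mul_self_ne_zero.2 hr0)
  exact h4.ne' h3

/-- The unknown multiple is fixed at `t = 1`: there the chord shrinks to the point `(1, 0)` and the
integrand is constant apart from the weight. -/
theorem chordAverage_jacobiOrthonormal_eval {μ : ℝ} (hμ : 0 ≤ μ) (m l : ℕ) (t : ℝ) :
    (gegenbauer (μ + 1 / 2) (m + 2 * l)).eval 1 *
      (chordAverage μ hμ (chordPoly (jacobiOrthonormal (μ - 1 / 2) m l) m)).eval t =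
    (∫ s in (-1 : ℝ)..1, (1 - s ^ 2) ^ (μ - 1 / 2)) *
      (jacobiOrthonormal (μ - 1 / 2) m l).eval 1 *
        (gegenbauer (μ + 1 / 2) (m + 2 * l)).eval t := by
  obtain ⟨e, he⟩ := chordAverage_jacobiOrthonormal hμ m l
  have h1 : (chordAverage μ hμ (chordPoly (jacobiOrthonormal (μ - 1 / 2) m l) m)).eval 1 =
      (∫ s in (-1 : ℝ)..1, (1 - s ^ 2) ^ (μ - 1 / 2)) *
        (jacobiOrthonormal (μ - 1 / 2) m l).eval 1 := by
    rw [chordAverage_eval, ← intervalIntegral.integral_mul_const]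
    refine intervalIntegral.integral_congr fun s _ => ?_
    rw [chordPoly_evalEval (u := 0) (by norm_num)]
    norm_num
    ring
  rw [← h1, he, eval_smul, eval_smul, smul_eq_mul, smul_eq_mul]
  ring

/-- The Radon projections of the orthogonal polynomials on the disk (Marr's formula). -/
theorem radon_discBasis {μ : ℝ} (hμ : 0 ≤ μ) (ε : Fin 2) {l k : ℕ} (hl : 2 * l ≤ k) (θ : ℝ)
    {t : ℝ} (ht : t ∈ Ioo (-1 : ℝ) 1) :
    (gegenbauer (μ + 1 / 2) k).eval 1 * radon μ (discBasis μ ε l k) θ t =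
      (1 - t ^ 2) ^ μ * (∫ s in (-1 : ℝ)..1, (1 - s ^ 2) ^ (μ - 1 / 2)) *
        (gegenbauer (μ + 1 / 2) k).eval t *
          discBasis μ ε l k (Real.cos θ) (Real.sin θ) := by
  obtain ⟨m, rfl⟩ : ∃ m, k = m + 2 * l := ⟨k - 2 * l, by omega⟩
  have hm : m + 2 * l - 2 * l = m := by omega
  have h0 := one_sub_sq_pos ht
  set u := √(1 - t ^ 2) with hu
  have hu2 : u ^ 2 = 1 - t ^ 2 := Real.sq_sqrt h0.le
  set p := jacobiOrthonormal (μ - 1 / 2) m l with hp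
  set cst := (if 2 * l < m + 2 * l then √2 else 1) * hConst μ l (m + 2 * l) with hcst
  let zre : ℝ → ℝ := fun s => p.eval (2 * (t ^ 2 + (u * s) ^ 2) - 1) *
    (((t : ℂ) + ((u * s : ℝ) : ℂ) * Complex.I) ^ m).re
  let zim : ℝ → ℝ := fun s => p.eval (2 * (t ^ 2 + (u * s) ^ 2) - 1) *
    (((t : ℂ) + ((u * s : ℝ) : ℂ) * Complex.I) ^ m).im
  -- A point of the chord is `e^{iθ} (t + i u s)`, so by the addition theorem the basis element is a
  -- combination of the real part `zre` and the imaginary part `zim` for the unrotated chord. The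
  -- latter is odd in `s` and integrates to zero.
  let S := angular ε m (Real.cos θ) (Real.sin θ)
  let S' := if ε = 0 then -Real.sin (m * θ) else Real.cos (m * θ)
  have hpt : ∀ s, discBasis μ ε l (m + 2 * l) (t * Real.cos θ - (u * s) * Real.sin θ)
      (t * Real.sin θ + (u * s) * Real.cos θ) = cst * S * zre s + cst * S' * zim s := by
    intro s
    have hsq : (t * Real.cos θ - (u * s) * Real.sin θ) ^ 2 +
        (t * Real.sin θ + (u * s) * Real.cos θ) ^ 2 = t ^ 2 + (u * s) ^ 2 := by
      linear_combination (t ^ 2 + (u * s) ^ 2) * Real.sin_sq_add_cos_sq θ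
    have hz : ((t * Real.cos θ - (u * s) * Real.sin θ : ℝ) : ℂ) +
        ((t * Real.sin θ + (u * s) * Real.cos θ : ℝ) : ℂ) * Complex.I =
        ((Real.cos θ : ℂ) + Real.sin θ * Complex.I) * ((t : ℂ) + ((u * s : ℝ) : ℂ) * Complex.I) := by
      push_cast
      linear_combination (-(u : ℂ) * s * Complex.sin θ) * Complex.I_sq
    have hc := angular_cos_sin 0 m θ
    have hs := angular_cos_sin 1 m θ
    simp only [angular, if_true, one_ne_zero, if_false] at hc hs
    rw [discBasis, hsq, hm, angular, hz, mul_pow (_ + _ : ℂ)]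
    simp only [S, S', zre, zim, ← hcst, ← hp, angular_cos_sin, Complex.mul_re, Complex.mul_im, hc,
      hs]
    split_ifs <;> ring
  have hw := intervalIntegrable_one_sub_sq_rpow_sub_half hμ
  have hre : IntervalIntegrable (fun s => zre s * (1 - s ^ 2) ^ (μ - 1 / 2)) volume (-1) 1 := by
    refine hw.continuousOn_mul (Continuous.continuousOn ?_)
    have := p.continuous
    fun_prop
  have him : IntervalIntegrable (fun s => zim s * (1 - s ^ 2) ^ (μ - 1 / 2)) volume (-1) 1 := by
    refine hw.continuousOn_mul (Continuous.continuousOn ?_)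
    have := p.continuous
    fun_prop
  have hodd : ∫ s in (-1 : ℝ)..1, zim s * (1 - s ^ 2) ^ (μ - 1 / 2) = 0 := by
    have h := intervalIntegral.integral_comp_neg (a := -1) (b := 1)
      (fun s => zim s * (1 - s ^ 2) ^ (μ - 1 / 2))
    have hneg : ∀ s, zim (-s) = -zim s := by
      intro s
      have hconj : ((t : ℂ) + ((u * -s : ℝ) : ℂ) * Complex.I) =
          (starRingEnd ℂ) ((t : ℂ) + ((u * s : ℝ) : ℂ) * Complex.I) := by
        simp
      have hsq : (u * -s) ^ 2 = (u * s) ^ 2 := by ring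
      simp only [zim]
      rw [hconj, hsq, ← map_pow, Complex.conj_im, mul_neg]
    simp only [hneg, neg_sq, neg_mul, intervalIntegral.integral_neg, neg_neg] at h
    linarith
  have hmain : radon μ (discBasis μ ε l (m + 2 * l)) θ t = (1 - t ^ 2) ^ μ * (cst * S *
      (chordAverage μ hμ (chordPoly p m)).eval t) := by
    rw [radon, integral_chord μ ht (fun s => discBasis μ ε l (m + 2 * l)
      (t * Real.cos θ - s * Real.sin θ) (t * Real.sin θ + s * Real.cos θ))]
    congr 1
    have e : ∀ s, discBasis μ ε l (m + 2 * l) (t * Real.cos θ - (u * s) * Real.sin θ)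
        (t * Real.sin θ + (u * s) * Real.cos θ) * (1 - s ^ 2) ^ (μ - 1 / 2) =
        cst * S * (zre s * (1 - s ^ 2) ^ (μ - 1 / 2)) +
          cst * S' * (zim s * (1 - s ^ 2) ^ (μ - 1 / 2)) := fun s => by rw [hpt]; ring
    simp only [← hu, e]
    rw [intervalIntegral.integral_add (hre.const_mul _) (him.const_mul _),
      intervalIntegral.integral_const_mul, intervalIntegral.integral_const_mul, hodd, mul_zero,
      add_zero, chordAverage_eval]
    simp only [chordPoly_evalEval hu2, zre]
  have hmarr := chordAverage_jacobiOrthonormal_eval hμ m l t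
  rw [hmain, discBasis_cos_sin, hm, HConst, hm]
  simp only [← hp] at hmarr ⊢
  simp only [S, hcst]
  linear_combination (1 - t ^ 2) ^ μ * (if 2 * l < m + 2 * l then √2 else 1) *
    hConst μ l (m + 2 * l) * angular ε m (Real.cos θ) (Real.sin θ) * hmarr

/-! ### Reproduction of products of orthogonal polynomials -/

theorem continuous_angular (ε : Fin 2) (m : ℕ) :
    Continuous fun q : ℝ × ℝ => angular ε m q.1 q.2 := by
  unfold angular
  split_ifs <;> fun_prop

theorem continuous_discBasis (μ : ℝ) (ε : Fin 2) (l k : ℕ) :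
    Continuous fun q : ℝ × ℝ => discBasis μ ε l k q.1 q.2 := by
  unfold discBasis
  have h1 := continuous_angular ε (k - 2 * l)
  have h2 := (jacobiOrthonormal (μ - 1 / 2) ((k - 2 * l : ℕ) : ℝ) l).continuous
  fun_prop

/-- After Marr's formula the factor `(1 - t_j²)^(-μ)` of the operator cancels the one from the
projection, and for each `k'` the summand is a product of functions of `ν`, `j` and `i` separately.
-/
theorem cylOperator_discBasis_mul_axialOrthonormal {μ : ℝ} (hμ : 0 ≤ μ) {L : ℝ} (hL : 0 < L)
    {n : ℕ} {a : ℝ} {t : Fin (n + 1) → ℝ} (ht_inj : Function.Injective t)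
    (ht_root : ∀ j, (gegenbauer (μ + 1 / 2) (n + 1) +
      C a * gegenbauer (μ + 1 / 2) n).eval (t j) = 0)
    (ht_mem : ∀ j, t j ∈ Ioo (-1 : ℝ) 1) (ε : Fin 2) {l k m : ℕ} (hl : 2 * l ≤ k)
    (hkm : k + m ≤ n) (x : Fin 3 → ℝ) :
    cylOperator μ L n t
      (fun x => discBasis μ ε l k (x 0) (x 1) * (axialOrthonormal L m).eval (x 2)) x =
    discBasis μ ε l k (x 0) (x 1) * (axialOrthonormal L m).eval (x 2) := by
  have hlam : 0 < μ + 1 / 2 := by positivity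
  have hC1 := (gegenbauer_eval_one_pos hlam k).ne'
  set C1 := (gegenbauer (μ + 1 / 2) k).eval 1 with hC1def
  set c := ∫ s in (-1 : ℝ)..1, (1 - s ^ 2) ^ (μ - 1 / 2) with hc
  set J := gegenbauerIntegral μ hμ with hJ
  have hn : ((n : ℝ) + 1) ≠ 0 := by positivity
  have hpi := Real.pi_pos.ne'
  -- All factors independent of the nodes: the normalization of the operator, the constant `c /
  -- C_k(1)` of Marr's formula, and the coefficient of `C_{k'}` in the kernel.
  let A : ℕ → ℝ := fun k' => ((μ + 1 / 2) / Real.pi) / ((n : ℝ) + 1) ^ 2 * (c / C1) *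
    ((k' + μ + 1 / 2) / (μ + 1 / 2))
  have hterm : ∀ ν j i : Fin (n + 1),
      radon μ (fun x₁ x₂ => discBasis μ ε l k (![x₁, x₂, zNode L n i] 0)
        (![x₁, x₂, zNode L n i] 1) * (axialOrthonormal L m).eval (![x₁, x₂, zNode L n i] 2))
        (angle n ν) (t j) * TPoly μ L n t ν j i x =
      ∑ k' ∈ Finset.range (n + 1), A k' *
        (discBasis μ ε l k (Real.cos (angle n ν)) (Real.sin (angle n ν)) *
          DKernel μ k' (angle n ν) (x 0) (x 1)) *
        (quadWeight μ t j * ((gegenbauer (μ + 1 / 2) k).eval (t j) *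
          (gegenbauer (μ + 1 / 2) k').eval (t j))) *
        ∑ l' ∈ Finset.range (n - k' + 1), (axialOrthonormal L m).eval (zNode L n i) *
          (axialOrthonormal L l').eval (zNode L n i) * (axialOrthonormal L l').eval (x 2) := by
    intro ν j i
    have h1 : radon μ (fun x₁ x₂ => discBasis μ ε l k (![x₁, x₂, zNode L n i] 0)
        (![x₁, x₂, zNode L n i] 1) * (axialOrthonormal L m).eval (![x₁, x₂, zNode L n i] 2))
        (angle n ν) (t j) = (axialOrthonormal L m).eval (zNode L n i) *
          radon μ (discBasis μ ε l k) (angle n ν) (t j) := by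
      rw [radon, radon, ← intervalIntegral.integral_const_mul]
      refine intervalIntegral.integral_congr fun s _ => ?_
      simp
      ring
    have h2 := radon_discBasis hμ ε hl (angle n ν) (ht_mem j)
    rw [← hC1def, ← hc] at h2
    have h3 : radon μ (discBasis μ ε l k) (angle n ν) (t j) = (1 - t j ^ 2) ^ μ * (c / C1) *
        (gegenbauer (μ + 1 / 2) k).eval (t j) *
          discBasis μ ε l k (Real.cos (angle n ν)) (Real.sin (angle n ν)) := by
      refine mul_left_cancel₀ hC1 ?_
      rw [h2]
      field_simp
    have h4 : (1 - t j ^ 2) ^ μ * (1 - t j ^ 2) ^ (-μ) = 1 := by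
      rw [← Real.rpow_add (one_sub_sq_pos (ht_mem j)), add_neg_cancel, Real.rpow_zero]
    rw [h1, h3, TPoly, PhiKernel, Finset.mul_sum, Finset.mul_sum]
    refine Finset.sum_congr rfl fun k' _ => ?_
    simp only [mul_assoc ((axialOrthonormal L m).eval (zNode L n i))]
    rw [← Finset.mul_sum]
    simp only [A]
    linear_combination (((μ + 1 / 2) / Real.pi) / ((n : ℝ) + 1) ^ 2 * (c / C1) *
      ((k' + μ + 1 / 2) / (μ + 1 / 2)) *
        (discBasis μ ε l k (Real.cos (angle n ν)) (Real.sin (angle n ν)) *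
          DKernel μ k' (angle n ν) (x 0) (x 1)) *
        (quadWeight μ t j * ((gegenbauer (μ + 1 / 2) k).eval (t j) *
          (gegenbauer (μ + 1 / 2) k').eval (t j))) *
        ((axialOrthonormal L m).eval (zNode L n i) * ∑ l' ∈ Finset.range (n - k' + 1),
          (axialOrthonormal L l').eval (zNode L n i) * (axialOrthonormal L l').eval (x 2))) * h4
  have hquad : ∀ k' ∈ Finset.range (n + 1),
      ∑ j, quadWeight μ t j * ((gegenbauer (μ + 1 / 2) k).eval (t j) *
        (gegenbauer (μ + 1 / 2) k').eval (t j)) =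
      J (gegenbauer (μ + 1 / 2) k * gegenbauer (μ + 1 / 2) k') := by
    intro k' hk'
    rw [hJ, ← sum_quadWeight_mul_eval hμ ht_inj ht_root]
    · simp only [eval_mul]
    · refine natDegree_mul_le.trans ?_
      rw [gegenbauer_natDegree hlam, gegenbauer_natDegree hlam]
      have := Finset.mem_range.1 hk'
      omega
  have haxial : ∑ i : Fin (n + 1), ∑ l' ∈ Finset.range (n - k + 1),
      (axialOrthonormal L m).eval (zNode L n i) *
        (axialOrthonormal L l').eval (zNode L n i) * (axialOrthonormal L l').eval (x 2) =
      (n + 1) * (axialOrthonormal L m).eval (x 2) := by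
    rw [Finset.sum_comm, Finset.sum_eq_single m]
    · rw [← Finset.sum_mul, sum_axialOrthonormal_mul_axialOrthonormal hL (by omega) (by omega),
        if_pos rfl]
    · intro l' hl' hne
      have := Finset.mem_range.1 hl'
      rw [← Finset.sum_mul, sum_axialOrthonormal_mul_axialOrthonormal hL (by omega) (by omega),
        if_neg hne.symm, zero_mul]
    · intro h
      exact absurd (Finset.mem_range.2 (by omega)) h
  have hsum : cylOperator μ L n t
      (fun x => discBasis μ ε l k (x 0) (x 1) * (axialOrthonormal L m).eval (x 2)) x =
      ∑ k' ∈ Finset.range (n + 1), A k' *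
        (∑ ν, discBasis μ ε l k (Real.cos (angle n ν)) (Real.sin (angle n ν)) *
          DKernel μ k' (angle n ν) (x 0) (x 1)) *
        (∑ j, quadWeight μ t j * ((gegenbauer (μ + 1 / 2) k).eval (t j) *
          (gegenbauer (μ + 1 / 2) k').eval (t j))) *
        ∑ i : Fin (n + 1), ∑ l' ∈ Finset.range (n - k' + 1),
          (axialOrthonormal L m).eval (zNode L n i) *
          (axialOrthonormal L l').eval (zNode L n i) * (axialOrthonormal L l').eval (x 2) := by
    rw [cylOperator]
    simp only [hterm]
    simp_rw [Finset.sum_comm (t := Finset.range (n + 1)), ← Finset.mul_sum, ← Finset.sum_mul,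
      ← Finset.mul_sum]
    refine Finset.sum_congr rfl fun k' _ => ?_
    rw [← Finset.sum_mul, ← Finset.mul_sum]
  rw [hsum, Finset.sum_eq_single_of_mem k (Finset.mem_range.2 (by omega))]
  · rw [hquad k (Finset.mem_range.2 (by omega)), haxial,
      sum_discBasis_mul_DKernel hμ (by omega) hl]
    have h1 := gegenbauerIntegral_gegenbauer_mul_self hμ k
    have h2 := integral_chord_mul_gegenbauerIntegral_one hμ
    rw [← hC1def, ← hJ] at h1
    rw [← hc, ← hJ, eq_div_iff hlam.ne'] at h2
    -- The norm formula turns `(k + μ + 1/2) J(C_k²)` into `(μ + 1/2) J(1) C_k(1)`, and `c J(1) = π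
    -- / (μ + 1/2)` cancels what is left.
    have h3 : A k * J (gegenbauer (μ + 1 / 2) k * gegenbauer (μ + 1 / 2) k) *
        ((n : ℝ) + 1) ^ 2 = 1 := by
      have h4 : A k * J (gegenbauer (μ + 1 / 2) k * gegenbauer (μ + 1 / 2) k) *
        ((n : ℝ) + 1) ^ 2 = c / C1 / Real.pi * ((k + (μ + 1 / 2)) *
          J (gegenbauer (μ + 1 / 2) k * gegenbauer (μ + 1 / 2) k)) := by
        simp only [A]
        field_simp
        ring
      rw [h4, h1, div_mul_eq_mul_div, div_eq_one_iff_eq hpi, ← h2, div_mul_eq_mul_div,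
        div_eq_iff hC1]
      ring
    linear_combination discBasis μ ε l k (x 0) (x 1) * (axialOrthonormal L m).eval (x 2) * h3
  · intro k' hk' hne
    rw [hquad k' hk', hJ, gegenbauerIntegral_gegenbauer_mul_gegenbauer hμ hne.symm]
    simp

/-! ### Linearity of the reconstruction operator -/

theorem intervalIntegrable_chord {μ : ℝ} (hμ : 0 ≤ μ) {t : ℝ} (ht : t ∈ Ioo (-1 : ℝ) 1) :
    IntervalIntegrable (fun s => (1 - s ^ 2 - t ^ 2) ^ (μ - 1 / 2)) volume
      (-√(1 - t ^ 2)) √(1 - t ^ 2) := by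
  have h := discWeight_slice_mul μ ht fun _ => 1
  simp only [mul_one, one_mul] at h
  have h2 := integrable_discWeight_slice hμ t
  rw [h, integrable_indicator_iff measurableSet_Ioo] at h2
  rwa [intervalIntegrable_iff_integrableOn_Ioo_of_le (neg_le_self (Real.sqrt_nonneg _))]

/-- Continuity secures integrability along the chord; without it the integral could take its default
value `0` and additivity could fail. -/
theorem radon_add {μ : ℝ} (hμ : 0 ≤ μ) {t : ℝ} (ht : t ∈ Ioo (-1 : ℝ) 1) (θ : ℝ)
    {f g : ℝ → ℝ → ℝ} (hf : Continuous fun q : ℝ × ℝ => f q.1 q.2)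
    (hg : Continuous fun q : ℝ × ℝ => g q.1 q.2) :
    radon μ (fun x y => f x y + g x y) θ t = radon μ f θ t + radon μ g θ t := by
  have hint : ∀ {h : ℝ → ℝ → ℝ}, (Continuous fun q : ℝ × ℝ => h q.1 q.2) →
      IntervalIntegrable (fun s => h (t * Real.cos θ - s * Real.sin θ)
        (t * Real.sin θ + s * Real.cos θ) * (1 - s ^ 2 - t ^ 2) ^ (μ - 1 / 2)) volume
      (-√(1 - t ^ 2)) √(1 - t ^ 2) := fun {h} hh =>
    (intervalIntegrable_chord hμ ht).continuousOn_mul (Continuous.continuousOn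
      (hh.comp (g := fun q : ℝ × ℝ => h q.1 q.2)
        (f := fun s => (t * Real.cos θ - s * Real.sin θ, t * Real.sin θ + s * Real.cos θ))
        (by fun_prop)))
  rw [radon, radon, radon, ← intervalIntegral.integral_add (hint hf) (hint hg)]
  simp only [add_mul]

theorem radon_const_mul (μ c θ t : ℝ) (f : ℝ → ℝ → ℝ) :
    radon μ (fun x y => c * f x y) θ t = c * radon μ f θ t := by
  rw [radon, radon, ← intervalIntegral.integral_const_mul]
  simp only [mul_assoc]

/-- The continuous functions that the reconstruction operator reproduces. -/
def reproduced {μ : ℝ} (hμ : 0 ≤ μ) (L : ℝ) {n : ℕ} {t : Fin (n + 1) → ℝ}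
    (ht_mem : ∀ j, t j ∈ Ioo (-1 : ℝ) 1) : Submodule ℝ ((Fin 3 → ℝ) → ℝ) where
  carrier := {f | Continuous f ∧ ∀ x, cylOperator μ L n t f x = f x}
  zero_mem' := ⟨continuous_const, fun x => by simp [cylOperator, radon]⟩
  add_mem' {f g} hf hg := by
    refine ⟨hf.1.add hg.1, fun x => ?_⟩
    have hfc := hf.1
    have hgc := hg.1
    rw [Pi.add_apply, ← hf.2 x, ← hg.2 x]
    simp only [cylOperator, ← Finset.sum_add_distrib]
    refine Finset.sum_congr rfl fun ν _ => Finset.sum_congr rfl fun j _ =>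
      Finset.sum_congr rfl fun i _ => ?_
    rw [← add_mul, ← radon_add hμ (ht_mem j) (angle n ν)
      (f := fun x₁ x₂ => f ![x₁, x₂, zNode L n i]) (g := fun x₁ x₂ => g ![x₁, x₂, zNode L n i])
      (hfc.comp (by fun_prop)) (hgc.comp (by fun_prop))]
    rfl
  smul_mem' c f hf := by
    refine ⟨hf.1.const_smul c, fun x => ?_⟩
    rw [Pi.smul_apply, ← hf.2 x, smul_eq_mul]
    simp only [cylOperator, Finset.mul_sum]
    refine Finset.sum_congr rfl fun ν _ => Finset.sum_congr rfl fun j _ =>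
      Finset.sum_congr rfl fun i _ => ?_
    rw [← mul_assoc, ← radon_const_mul]
    rfl

/-- The operator samples `f` only on chords of the unit disk at heights `z_i ∈ [0, L]`. -/
theorem cylOperator_congr (μ : ℝ) {L : ℝ} (hL : 0 < L) {n : ℕ} {t : Fin (n + 1) → ℝ}
    (ht_mem : ∀ j, t j ∈ Ioo (-1 : ℝ) 1) {f g : (Fin 3 → ℝ) → ℝ}
    (h : ∀ x ∈ cylinder L, f x = g x) (x : Fin 3 → ℝ) :
    cylOperator μ L n t f x = cylOperator μ L n t g x := by
  simp only [cylOperator]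
  refine Finset.sum_congr rfl fun ν _ => Finset.sum_congr rfl fun j _ =>
    Finset.sum_congr rfl fun i _ => ?_
  congr 1
  refine intervalIntegral.integral_congr fun s hs => ?_
  have h0 := one_sub_sq_pos (ht_mem j)
  rw [uIcc_of_le (neg_le_self (Real.sqrt_nonneg _))] at hs
  have hs2 : s ^ 2 ≤ 1 - t j ^ 2 := Real.sq_le h0.le |>.2 hs
  simp only
  rw [h]
  obtain ⟨hz0, hzL⟩ := zNode_mem hL n i
  refine ⟨?_, hz0, hzL⟩
  simp only [Matrix.cons_val_zero, Matrix.cons_val_one]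
  have := Real.sin_sq_add_cos_sq (angle n ν)
  have e : (t j * Real.cos (angle n ν) - s * Real.sin (angle n ν)) ^ 2 +
      (t j * Real.sin (angle n ν) + s * Real.cos (angle n ν)) ^ 2 = t j ^ 2 + s ^ 2 := by
    linear_combination (t j ^ 2 + s ^ 2) * this
  rw [e]
  linarith

/-! ### The disk basis spans the polynomials in two variables -/

/-- The homogeneous function `r^{2j} r^m cos(m φ)` (`ε = 0`) or `r^{2j} r^m sin(m φ)` (`ε = 1`). -/
def radialAngular (j : ℕ) (ε : Fin 2) (m : ℕ) : ℝ → ℝ → ℝ := fun x y =>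
  (x ^ 2 + y ^ 2) ^ j * angular ε m x y

/-- The span of the functions `radialAngular` of degree at most `d`. -/
def radialAngularSpan (d : ℕ) : Submodule ℝ (ℝ → ℝ → ℝ) :=
  Submodule.span ℝ {q | ∃ j ε m, 2 * j + m ≤ d ∧ q = radialAngular j ε m}

/-- The span of the disk basis up to degree `d`. -/
def discSpan (μ : ℝ) (d : ℕ) : Submodule ℝ (ℝ → ℝ → ℝ) :=
  Submodule.span ℝ {q | ∃ ε l k, 2 * l ≤ k ∧ k ≤ d ∧ q = discBasis μ ε l k}

theorem angular_zero_zero (x y : ℝ) : angular 0 0 x y = 1 := by simp [angular]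

theorem angular_one_zero (x y : ℝ) : angular 1 0 x y = 0 := by simp [angular]

theorem angular_zero_one (x y : ℝ) : angular 0 1 x y = x := by simp [angular]

theorem angular_one_one (x y : ℝ) : angular 1 1 x y = y := by simp [angular]

theorem angular_add_two (ε : Fin 2) (m : ℕ) (x y : ℝ) :
    angular ε (m + 2) x y =
      2 * x * angular ε (m + 1) x y - (x ^ 2 + y ^ 2) * angular ε m x y := by
  have hz : ((x : ℂ) + y * Complex.I) ^ (m + 2) =
      ((2 * x : ℝ) : ℂ) * ((x : ℂ) + y * Complex.I) ^ (m + 1) -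
        ((x ^ 2 + y ^ 2 : ℝ) : ℂ) * ((x : ℂ) + y * Complex.I) ^ m := by
    push_cast
    linear_combination (y : ℂ) ^ 2 * ((x : ℂ) + y * Complex.I) ^ m * Complex.I_sq
  simp only [angular, hz, Complex.sub_re, Complex.sub_im, Complex.re_ofReal_mul,
    Complex.im_ofReal_mul]
  split_ifs <;> rfl

theorem angular_add_two' (m : ℕ) (x y : ℝ) :
    angular 0 (m + 2) x y =
        -2 * y * angular 1 (m + 1) x y + (x ^ 2 + y ^ 2) * angular 0 m x y ∧
      angular 1 (m + 2) x y =
        2 * y * angular 0 (m + 1) x y + (x ^ 2 + y ^ 2) * angular 1 m x y := by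
  have hz : ((x : ℂ) + y * Complex.I) ^ (m + 2) =
      ((2 * y : ℝ) : ℂ) * (Complex.I * ((x : ℂ) + y * Complex.I) ^ (m + 1)) +
        ((x ^ 2 + y ^ 2 : ℝ) : ℂ) * ((x : ℂ) + y * Complex.I) ^ m := by
    push_cast
    linear_combination (-(y : ℂ) ^ 2) * ((x : ℂ) + y * Complex.I) ^ m * Complex.I_sq
  simp only [angular, if_true, one_ne_zero, if_false, hz, Complex.add_re, Complex.add_im,
    Complex.re_ofReal_mul, Complex.im_ofReal_mul, Complex.I_mul_re, Complex.I_mul_im]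
  exact ⟨by ring, trivial⟩

theorem radialAngular_mem {j m d : ℕ} (ε : Fin 2) (h : 2 * j + m ≤ d) :
    radialAngular j ε m ∈ radialAngularSpan d :=
  Submodule.subset_span ⟨j, ε, m, h, rfl⟩

/-- The product formula for `cos φ` times a harmonic of order `m` gives orders `m ± 1`; lowering the
order frees a factor `r²`, so the degree count rises by exactly one. -/
theorem fst_mul_mem_radialAngularSpan {d : ℕ} {q : ℝ → ℝ → ℝ} (hq : q ∈ radialAngularSpan d) :
    (fun x y => x * q x y) ∈ radialAngularSpan (d + 1) := by
  refine Submodule.span_induction (p := fun q _ => (fun x y => x * q x y) ∈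
    radialAngularSpan (d + 1)) ?_ ?_ ?_ ?_ hq
  · rintro _ ⟨j, ε, m, hd, rfl⟩
    cases m with
    | zero =>
      match ε with
      | 0 =>
        convert radialAngular_mem (j := j) (m := 1) (d := d + 1) 0 (by omega) using 3 with x y
        simp [radialAngular, angular_zero_zero, angular_zero_one, mul_comm]
      | 1 =>
        convert (radialAngularSpan (d + 1)).zero_mem using 3 with x y
        simp [radialAngular, angular_one_zero]
    | succ m =>
      have e : (fun x y => x * radialAngular j ε (m + 1) x y) =
          (1 / 2 : ℝ) • radialAngular j ε (m + 2) + (1 / 2 : ℝ) • radialAngular (j + 1) ε m := by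
        funext x y
        simp only [radialAngular, Pi.add_apply, Pi.smul_apply, smul_eq_mul, angular_add_two]
        ring
      rw [e]
      exact Submodule.add_mem _ (Submodule.smul_mem _ _ (radialAngular_mem ε (by omega)))
        (Submodule.smul_mem _ _ (radialAngular_mem ε (by omega)))
  · convert (radialAngularSpan (d + 1)).zero_mem using 3 with x y
    simp
  · intro f g _ _ hf hg
    convert (radialAngularSpan (d + 1)).add_mem hf hg using 3 with x y
    simp [mul_add]
  · intro c f _ hf
    convert (radialAngularSpan (d + 1)).smul_mem c hf using 3 with x y
    simp [mul_left_comm]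

theorem snd_mul_mem_radialAngularSpan {d : ℕ} {q : ℝ → ℝ → ℝ} (hq : q ∈ radialAngularSpan d) :
    (fun x y => y * q x y) ∈ radialAngularSpan (d + 1) := by
  refine Submodule.span_induction (p := fun q _ => (fun x y => y * q x y) ∈
    radialAngularSpan (d + 1)) ?_ ?_ ?_ ?_ hq
  · rintro _ ⟨j, ε, m, hd, rfl⟩
    cases m with
    | zero =>
      match ε with
      | 0 =>
        convert radialAngular_mem (j := j) (m := 1) (d := d + 1) 1 (by omega) using 3 with x y
        simp [radialAngular, angular_zero_zero, angular_one_one, mul_comm]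
      | 1 =>
        convert (radialAngularSpan (d + 1)).zero_mem using 3 with x y
        simp [radialAngular, angular_one_zero]
    | succ m =>
      match ε with
      | 0 =>
        have e : (fun x y => y * radialAngular j 0 (m + 1) x y) =
            (1 / 2 : ℝ) • radialAngular j 1 (m + 2) -
              (1 / 2 : ℝ) • radialAngular (j + 1) 1 m := by
          funext x y
          simp only [radialAngular, Pi.sub_apply, Pi.smul_apply, smul_eq_mul,
            (angular_add_two' m x y).2]
          ring
        rw [e]
        exact Submodule.sub_mem _ (Submodule.smul_mem _ _ (radialAngular_mem 1 (by omega)))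
          (Submodule.smul_mem _ _ (radialAngular_mem 1 (by omega)))
      | 1 =>
        have e : (fun x y => y * radialAngular j 1 (m + 1) x y) =
            (1 / 2 : ℝ) • radialAngular (j + 1) 0 m -
              (1 / 2 : ℝ) • radialAngular j 0 (m + 2) := by
          funext x y
          simp only [radialAngular, Pi.sub_apply, Pi.smul_apply, smul_eq_mul,
            (angular_add_two' m x y).1]
          ring
        rw [e]
        exact Submodule.sub_mem _ (Submodule.smul_mem _ _ (radialAngular_mem 0 (by omega)))
          (Submodule.smul_mem _ _ (radialAngular_mem 0 (by omega)))
  · convert (radialAngularSpan (d + 1)).zero_mem using 3 with x y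
    simp
  · intro f g _ _ hf hg
    convert (radialAngularSpan (d + 1)).add_mem hf hg using 3 with x y
    simp [mul_add]
  · intro c f _ hf
    convert (radialAngularSpan (d + 1)).smul_mem c hf using 3 with x y
    simp [mul_left_comm]

theorem pow_mul_pow_mem_radialAngularSpan (a b : ℕ) :
    (fun x y : ℝ => x ^ a * y ^ b) ∈ radialAngularSpan (a + b) := by
  induction a with
  | zero =>
    induction b with
    | zero =>
      convert radialAngular_mem (j := 0) (m := 0) (d := 0 + 0) 0 (by omega) using 3 with x y
      simp [radialAngular, angular_zero_zero]
    | succ b ih =>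
      have e : (fun x y : ℝ => x ^ 0 * y ^ (b + 1)) = fun x y => y * (x ^ 0 * y ^ b) := by
        funext x y; ring
      rw [e]
      exact snd_mul_mem_radialAngularSpan ih
  | succ a ih =>
    rw [add_right_comm]
    have e : (fun x y : ℝ => x ^ (a + 1) * y ^ b) = fun x y => x * (x ^ a * y ^ b) := by
      funext x y; ring
    rw [e]
    exact fst_mul_mem_radialAngularSpan ih

/-- For fixed `m` the radial factor is expanded in the Jacobi polynomials with second parameter `m`;
the one of degree `l` yields a basis element of degree `m + 2 l`. -/
theorem eval_mul_angular_mem_discSpan {μ : ℝ} (hμ : 0 ≤ μ) (ε : Fin 2) (m : ℕ) (p : ℝ[X]) :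
    (fun x y => p.eval (2 * (x ^ 2 + y ^ 2) - 1) * angular ε m x y) ∈
      discSpan μ (m + 2 * p.natDegree) := by
  have hα : -1 < μ - 1 / 2 := by linarith
  have hm : (0 : ℝ) ≤ m := Nat.cast_nonneg m
  refine Submodule.span_induction (p := fun (q : ℝ[X]) _ =>
    (fun x y => q.eval (2 * (x ^ 2 + y ^ 2) - 1) * angular ε m x y) ∈
      discSpan μ (m + 2 * p.natDegree)) ?_ ?_ ?_ ?_
    (mem_span_of_natDegree_eq (jacobiOrthonormal_ne_zero hα hm)
      (jacobiOrthonormal_natDegree hα hm) p)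
  · rintro _ ⟨l, hl, rfl⟩
    set c := (if 2 * l < m + 2 * l then √2 else 1) * hConst μ l (m + 2 * l) with hc
    have hc0 : c ≠ 0 := by
      refine mul_ne_zero ?_ (hConst_pos hμ _ _).ne'
      split_ifs
      · exact (Real.sqrt_pos.2 two_pos).ne'
      · exact one_ne_zero
    have e : (fun x y => (jacobiOrthonormal (μ - 1 / 2) m l).eval (2 * (x ^ 2 + y ^ 2) - 1) *
        angular ε m x y) = c⁻¹ • discBasis μ ε l (m + 2 * l) := by
      funext x y
      rw [Pi.smul_apply, Pi.smul_apply, smul_eq_mul, discBasis, ← hc, Nat.add_sub_cancel,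
        mul_assoc c, inv_mul_cancel_left₀ hc0]
    rw [e]
    have := mem_Iic.1 hl
    exact Submodule.smul_mem _ _ (Submodule.subset_span ⟨ε, l, m + 2 * l, by omega, by omega, rfl⟩)
  · convert (discSpan μ (m + 2 * p.natDegree)).zero_mem using 3 with x y
    simp
  · intro f g _ _ hf hg
    convert (discSpan μ (m + 2 * p.natDegree)).add_mem hf hg using 3 with x y
    simp [add_mul]
  · intro c f _ hf
    convert (discSpan μ (m + 2 * p.natDegree)).smul_mem c hf using 3 with x y
    simp [mul_assoc]

theorem discSpan_mono (μ : ℝ) {d e : ℕ} (h : d ≤ e) : discSpan μ d ≤ discSpan μ e :=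
  Submodule.span_mono fun _ ⟨ε, l, k, hl, hk, hq⟩ => ⟨ε, l, k, hl, hk.trans h, hq⟩

theorem radialAngularSpan_le_discSpan {μ : ℝ} (hμ : 0 ≤ μ) (d : ℕ) :
    radialAngularSpan d ≤ discSpan μ d := by
  refine Submodule.span_le.2 ?_
  rintro _ ⟨j, ε, m, hd, rfl⟩
  -- This polynomial represents `r^(2j)`, since `r² = (v + 1) / 2` for `v = 2 r² - 1`.
  have hdeg : ((C (1 / 2) * (X + 1) : ℝ[X]) ^ j).natDegree ≤ j := by
    refine natDegree_pow_le.trans ?_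
    have : (C (1 / 2) * (X + 1) : ℝ[X]).natDegree ≤ 1 :=
      (natDegree_C_mul_le _ _).trans ((natDegree_add_le _ _).trans (by simp))
    nlinarith
  have h := eval_mul_angular_mem_discSpan hμ ε m ((C (1 / 2) * (X + 1)) ^ j)
  refine discSpan_mono μ (d := m + 2 * ((C (1 / 2) * (X + 1) : ℝ[X]) ^ j).natDegree) (by omega) ?_
  convert h using 3 with x y
  simp only [radialAngular, eval_pow, eval_mul, eval_C, eval_add, eval_X, eval_one]
  ring

/-- The product `q(x₀, x₁) p(x₂)`, as a bilinear map. -/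
def cylinderProduct : (ℝ → ℝ → ℝ) →ₗ[ℝ] ℝ[X] →ₗ[ℝ] ((Fin 3 → ℝ) → ℝ) :=
  LinearMap.mk₂ ℝ (fun q p x => q (x 0) (x 1) * p.eval (x 2))
    (fun q q' p => by funext x; simp [add_mul]) (fun c q p => by funext x; simp [mul_assoc])
    (fun q p p' => by funext x; simp [mul_add]) (fun c q p => by funext x; simp [mul_left_comm])

/-- Bilinearity allows the disk factor and the axial factor to be expanded separately, each
expansion respecting its degree bound. -/
theorem cylinderProduct_mem {L : ℝ} (hL : 0 < L) (μ : ℝ) {n d : ℕ}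
    {S : Submodule ℝ ((Fin 3 → ℝ) → ℝ)}
    (hS : ∀ ε l k m, 2 * l ≤ k → k + m ≤ n →
      cylinderProduct (discBasis μ ε l k) (axialOrthonormal L m) ∈ S)
    {q : ℝ → ℝ → ℝ} (hq : q ∈ discSpan μ d) {p : ℝ[X]} (hp : d + p.natDegree ≤ n) :
    cylinderProduct q p ∈ S := by
  have h : discSpan μ d ≤ S.comap (cylinderProduct.flip p) := by
    refine Submodule.span_le.2 ?_
    rintro _ ⟨ε, l, k, hl, hk, rfl⟩
    have h2 : Submodule.span ℝ (axialOrthonormal L '' Iic p.natDegree) ≤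
        S.comap (cylinderProduct (discBasis μ ε l k)) := by
      refine Submodule.span_le.2 ?_
      rintro _ ⟨m, hm, rfl⟩
      have := mem_Iic.1 hm
      exact hS ε l k m hl (by omega)
    exact h2 (mem_span_of_natDegree_eq (axialOrthonormal_ne_zero hL)
      (axialOrthonormal_natDegree hL) p)
  exact h hq

theorem eval_mem_of_cylinderProduct_mem {L : ℝ} (hL : 0 < L) {μ : ℝ} (hμ : 0 ≤ μ) {n : ℕ}
    {S : Submodule ℝ ((Fin 3 → ℝ) → ℝ)}
    (hS : ∀ ε l k m, 2 * l ≤ k → k + m ≤ n →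
      cylinderProduct (discBasis μ ε l k) (axialOrthonormal L m) ∈ S)
    {P : MvPolynomial (Fin 3) ℝ} (hP : P.totalDegree ≤ n) :
    (fun x => MvPolynomial.eval x P) ∈ S := by
  have e : (fun x => MvPolynomial.eval x P) = ∑ d ∈ P.support, P.coeff d •
      cylinderProduct (fun x y => x ^ d 0 * y ^ d 1) (X ^ d 2) := by
    funext x
    rw [MvPolynomial.eval_eq', Finset.sum_apply]
    refine Finset.sum_congr rfl fun d _ => ?_
    rw [Fin.prod_univ_three, Pi.smul_apply, smul_eq_mul]
    simp [cylinderProduct]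
  rw [e]
  refine Submodule.sum_mem _ fun d hd => Submodule.smul_mem _ _ ?_
  refine cylinderProduct_mem hL μ hS
    (radialAngularSpan_le_discSpan hμ _ (pow_mul_pow_mem_radialAngularSpan (d 0) (d 1))) ?_
  have h := (MvPolynomial.le_totalDegree hd).trans hP
  rw [Finsupp.sum_fintype _ _ (fun _ => rfl), Fin.sum_univ_three] at h
  rwa [natDegree_X_pow]

/-! ### The range of the reconstruction operator -/

/-- The polynomial functions of total degree at most `d` in three variables. -/
def polyFun (d : ℕ) : Submodule ℝ ((Fin 3 → ℝ) → ℝ) where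
  carrier := {g | ∃ P : MvPolynomial (Fin 3) ℝ, P.totalDegree ≤ d ∧
    ∀ x, g x = MvPolynomial.eval x P}
  zero_mem' := ⟨0, by simp, by simp⟩
  add_mem' := by
    rintro f g ⟨P, hP, hf⟩ ⟨Q, hQ, hg⟩
    exact ⟨P + Q, (MvPolynomial.totalDegree_add _ _).trans (max_le hP hQ), fun x => by
      simp [hf, hg]⟩
  smul_mem' := by
    rintro c f ⟨P, hP, hf⟩
    exact ⟨c • P, (MvPolynomial.totalDegree_smul_le _ _).trans hP, fun x => by
      simp [hf, MvPolynomial.smul_eval]⟩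

theorem polyFun_mono {d e : ℕ} (h : d ≤ e) : polyFun d ≤ polyFun e :=
  fun _ ⟨P, hP, hf⟩ => ⟨P, hP.trans h, hf⟩

theorem polyFun_mul {d e : ℕ} {f g : (Fin 3 → ℝ) → ℝ} (hf : f ∈ polyFun d) (hg : g ∈ polyFun e) :
    (fun x => f x * g x) ∈ polyFun (d + e) := by
  obtain ⟨P, hP, hf⟩ := hf
  obtain ⟨Q, hQ, hg⟩ := hg
  exact ⟨P * Q, (MvPolynomial.totalDegree_mul _ _).trans (add_le_add hP hQ), fun x => by
    simp [hf, hg]⟩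

theorem polyFun_const (c : ℝ) (d : ℕ) : (fun _ => c) ∈ polyFun d :=
  ⟨MvPolynomial.C c, by simp, by simp⟩

theorem polyFun_const_mul {d : ℕ} (c : ℝ) {f : (Fin 3 → ℝ) → ℝ} (hf : f ∈ polyFun d) :
    (fun x => c * f x) ∈ polyFun d :=
  (polyFun d).smul_mem c hf

theorem polyFun_coord (i : Fin 3) : (fun x => x i) ∈ polyFun 1 :=
  ⟨MvPolynomial.X i, by simp, by simp⟩

theorem polyFun_sum {d : ℕ} {ι : Type*} {s : Finset ι} {f : ι → (Fin 3 → ℝ) → ℝ}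
    (h : ∀ i ∈ s, f i ∈ polyFun d) : (fun x => ∑ i ∈ s, f i x) ∈ polyFun d := by
  have e : (fun x => ∑ i ∈ s, f i x) = ∑ i ∈ s, f i := by
    funext x
    rw [Finset.sum_apply]
  rw [e]
  exact Submodule.sum_mem _ h

theorem polyFun_pow {d : ℕ} {f : (Fin 3 → ℝ) → ℝ} (hf : f ∈ polyFun d) (k : ℕ) :
    (fun x => f x ^ k) ∈ polyFun (d * k) := by
  induction k with
  | zero => simpa using polyFun_const 1 0
  | succ k ih => simpa only [pow_succ, mul_add_one] using polyFun_mul ih hf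

theorem polyFun_eval {d : ℕ} {f : (Fin 3 → ℝ) → ℝ} (hf : f ∈ polyFun d) (p : ℝ[X]) :
    (fun x => p.eval (f x)) ∈ polyFun (d * p.natDegree) := by
  simp only [eval_eq_sum_range]
  refine polyFun_sum fun i hi => polyFun_const_mul _ (polyFun_mono ?_ (polyFun_pow hf i))
  exact Nat.mul_le_mul_left d (Nat.le_of_lt_succ (Finset.mem_range.1 hi))

theorem radiusSq_mem_polyFun : (fun x : Fin 3 → ℝ => x 0 ^ 2 + x 1 ^ 2) ∈ polyFun 2 :=
  (polyFun 2).add_mem (polyFun_pow (polyFun_coord 0) 2) (polyFun_pow (polyFun_coord 1) 2)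

theorem angular_mem_polyFun (ε : Fin 2) (m : ℕ) :
    (fun x : Fin 3 → ℝ => angular ε m (x 0) (x 1)) ∈ polyFun m := by
  induction m using Nat.twoStepInduction with
  | zero =>
    match ε with
    | 0 => simpa only [angular_zero_zero] using polyFun_const 1 0
    | 1 => simpa only [angular_one_zero] using polyFun_const 0 0
  | one =>
    match ε with
    | 0 => simpa only [angular_zero_one] using polyFun_coord 0
    | 1 => simpa only [angular_one_one] using polyFun_coord 1
  | more m ih1 ih2 =>
    simp only [angular_add_two]
    refine (polyFun (m + 2)).sub_mem
      (polyFun_mono (by omega) (polyFun_mul (polyFun_const_mul 2 (polyFun_coord 0)) ih2))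
      (polyFun_mono (by omega) (polyFun_mul radiusSq_mem_polyFun ih1))

theorem discBasis_mem_polyFun {μ : ℝ} (hμ : 0 ≤ μ) (ε : Fin 2) {l k : ℕ} (hl : 2 * l ≤ k) :
    (fun x : Fin 3 → ℝ => discBasis μ ε l k (x 0) (x 1)) ∈ polyFun k := by
  simp only [discBasis, mul_assoc]
  refine polyFun_const_mul _ (polyFun_const_mul _ ?_)
  have h1 := polyFun_eval ((polyFun 2).sub_mem (polyFun_const_mul 2 radiusSq_mem_polyFun)
    (polyFun_const 1 2)) (jacobiOrthonormal (μ - 1 / 2) ((k - 2 * l : ℕ) : ℝ) l)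
  rw [jacobiOrthonormal_natDegree (by linarith) (by positivity)] at h1
  exact polyFun_mono (by omega) (polyFun_mul h1 (angular_mem_polyFun ε (k - 2 * l)))

theorem PhiKernel_mem_polyFun {μ : ℝ} (hμ : 0 ≤ μ) {L : ℝ} (hL : 0 < L) (n : ℕ) (ξ w t : ℝ) :
    PhiKernel μ L n ξ w t ∈ polyFun n := by
  refine polyFun_sum fun k hk => ?_
  have hk' := Finset.mem_range.1 hk
  have h1 : (fun x : Fin 3 → ℝ => DKernel μ k ξ (x 0) (x 1)) ∈ polyFun k := by
    refine polyFun_sum fun l hl => polyFun_sum fun ε _ => polyFun_const_mul _ ?_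
    have := Finset.mem_range.1 hl
    exact discBasis_mem_polyFun hμ ε (by omega)
  have h2 : (fun x : Fin 3 → ℝ => ∑ l ∈ Finset.range (n - k + 1),
      (axialOrthonormal L l).eval w * (axialOrthonormal L l).eval (x 2)) ∈ polyFun (n - k) := by
    refine polyFun_sum fun l hl => polyFun_const_mul _ ?_
    have h := polyFun_eval (polyFun_coord 2) (axialOrthonormal L l)
    rw [axialOrthonormal_natDegree hL] at h
    have := Finset.mem_range.1 hl
    exact polyFun_mono (by omega) h
  exact polyFun_mono (by omega) (polyFun_mul (polyFun_const_mul _ h1) h2)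

/-- The data of `f` enter only as scalar coefficients, so no integrability is needed: a projection
that does not exist has the default value `0`. -/
theorem cylOperator_mem_polyFun {μ : ℝ} (hμ : 0 ≤ μ) {L : ℝ} (hL : 0 < L) {n : ℕ}
    (t : Fin (n + 1) → ℝ) (f : (Fin 3 → ℝ) → ℝ) : cylOperator μ L n t f ∈ polyFun n :=
  polyFun_sum fun _ _ => polyFun_sum fun _ _ => polyFun_sum fun _ _ =>
    polyFun_const_mul _ (polyFun_const_mul _ (PhiKernel_mem_polyFun hμ hL n _ _ _))

end CylRecon

end

theorem theorem5p5 (μ : ℝ) (hμ : 0 ≤ μ) (L : ℝ) (hL : 0 < L) (n : ℕ) (a : ℝ)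
    (t : Fin (n + 1) → ℝ) (ht_inj : Function.Injective t)
    (ht_root : ∀ j, (CylRecon.gegenbauer (μ + 1 / 2) (n + 1) +
      Polynomial.C a * CylRecon.gegenbauer (μ + 1 / 2) n).eval (t j) = 0)
    (ht_mem : ∀ j, t j ∈ Set.Ioo (-1 : ℝ) 1) :
    (∀ f : (Fin 3 → ℝ) → ℝ, ∃ P : MvPolynomial (Fin 3) ℝ, P.totalDegree ≤ n ∧
      ∀ x, CylRecon.cylOperator μ L n t f x = MvPolynomial.eval x P) ∧
    (∀ P : MvPolynomial (Fin 3) ℝ, P.totalDegree ≤ n →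
      ∀ f : (Fin 3 → ℝ) → ℝ, (∀ x ∈ CylRecon.cylinder L, f x = MvPolynomial.eval x P) →
        ∀ x, CylRecon.cylOperator μ L n t f x = MvPolynomial.eval x P) := by
  refine ⟨CylRecon.cylOperator_mem_polyFun hμ hL t, fun P hP f hf x => ?_⟩
  -- Off the cylinder `f` is arbitrary; replacing it by the polynomial itself supplies the
  -- continuity required in `reproduced`.
  rw [CylRecon.cylOperator_congr μ hL ht_mem hf]
  have hmem : (fun x => MvPolynomial.eval x P) ∈ CylRecon.reproduced hμ L ht_mem := by
    refine CylRecon.eval_mem_of_cylinderProduct_mem (S := CylRecon.reproduced hμ L ht_mem)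
      hL hμ (fun ε l k m hl hkm => ⟨?_, ?_⟩) hP
    · have h1 := (CylRecon.continuous_discBasis μ ε l k).comp
        (f := fun x : Fin 3 → ℝ => (x 0, x 1)) (by fun_prop)
      have h2 := (CylRecon.axialOrthonormal L m).continuous.comp
        (f := fun x : Fin 3 → ℝ => x 2) (by fun_prop)
      exact h1.mul h2
    · exact CylRecon.cylOperator_discBasis_mul_axialOrthonormal hμ hL ht_inj ht_root ht_mem ε hl hkm
  exact hmem.2 x
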